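/- **Setting.** Let $w^{wp}\in C([0,T];L^2(\mathbb R^3_x\times\mathbb R^3_v))$ be real-valued, with $w^{wp}_0:=w^{wp}(0)$, and let $\lambda=\frac1{4\pi}$. For a vector field $E=\nabla V$ on $\mathbb R^3$ put $$W(x,\eta)=\int_{-1/2}^{1/2}E(x-r\eta)\,dr,\qquad \delta V(x,\eta)=\eta\cdot W(x,\eta),$$ $$\Gamma[E]u=\mathcal F^{-1}_{\eta\to v}\big(W(x,\eta)\,\mathcal F_{v\to\eta}u\big),\qquad \Theta[V]u=\mathcal F^{-1}_{\eta\to v}\big(i\,\delta V(x,\eta)\,\mathcal F_{v\to\eta}u\big),$$ where, for $u\in L^2(\mathbb R^6)$ and $E\in L^2(\mathbb R^3)^3$, $\Gamma[E]u$ and $\Theta[V]u$ are defined as distributions by the symmetry of $\Gamma_k[E]$ and the skew-symmetry of $\Theta[V]$. The fields are $$E_0^{wp}(\cdot,t)=\lambda\frac{x}{|x|^3}*_x\int w^{wp}_0(x-tv,v)\,dv,$$ $$(E_1^{wp})_j(\cdot,t)=\lambda\frac{x_j}{|x|^3}*_x\operatorname{div}_x\int_0^t s\int\big(\Gamma[E^{wp}]w^{wp}\big)(x-sv,v,t-s)\,dv\,ds,\qquad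 E^{wp}=E_0^{wp}+E_1^{wp},$$ where $E_1^{wp}\in C((0,T];L^2(\mathbb R^3)^3)$ solves the second equation (a linear Volterra equation for $E_1^{wp}$, read in the sense of tempered distributions) for every $t\in(0,T]$, with $\int_0^T\|E_1^{wp}(t)\|_2\,dt<\infty$. The function $w^{wp}$ is a *mild solution of the Wigner–Poisson equation* on $[0,T]$ with self-consistent field $\nabla V=E^{wp}$ if, in the sense of tempered distributions and for all $t\in[0,T]$, $$w^{wp}(x,v,t)=w^{wp}_0(x-tv,v)+\int_0^t\big(\Theta[V]w^{wp}\big)(x-sv,v,t-s)\,ds.$$ **Proposition.** There is a universal constant $C>0$, and for each $\omega\in[0,1)$ a function $C_\omega(a,b,T)$, continuous in $T\in(0,\infty)$ for fixed $a,b$, such that the following holds. Let $T>0$ and let $w^{wp}$ be a mild solution of the Wigner–Poisson equation on $[0,T]$ with $\|w^{wp}(t)\|_2=\|w^{wp}_0\|_2$ for all $t\in[0,T]$, whose initial value satisfies, for some constant $C_T$, $$\textbf{(B)}\qquad\Big\|\int w^{wp}_0(x-tv,v)\,dv\Big\|_{L^{6/5}(\mathbb R^3_x)}\le C_T\,t^{-\omega}\qquad\forall\,t\in(0,T]$$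 (for each $t$, the integral is assumed to exist for almost every $x$). Then for all $t\in(0,T]$ the convolution defining $E_0^{wp}(t)$ converges absolutely almost everywhere, and $$\|E_0^{wp}(t)\|_2\le C\,\Big\|\int w^{wp}_0(x-tv,v)\,dv\Big\|_{L^{6/5}(\mathbb R^3_x)}\le C\,C_T\,t^{-\omega},$$ $$\|E_1^{wp}(t)\|_2\le C_\omega\Big(\|w^{wp}_0\|_2,\ \sup_{s\in(0,T]}\Big\{s^{\omega}\Big\|\int w^{wp}_0(x-sv,v)\,dv\Big\|_{L^{6/5}}\Big\},\ T\Big)\,t^{\frac12-\omega}.$$ -/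

import Mathlib

open MeasureTheory Set
open scoped SchwartzMap ENNReal

noncomputable section

namespace WP

/-- The space `ℝ³` of positions, of velocities and of their dual variables. -/
abbrev R3 : Type := EuclideanSpace ℝ (Fin 3)

/-- Phase space, `(x, v) ∈ ℝ³ × ℝ³`. -/
abbrev Phase : Type := R3 × R3

/-- Real-valued `L²` functions on phase space. -/
abbrev L2Phase : Type := Lp ℝ 2 (volume : Measure Phase)

/-- Square-integrable vector fields on `ℝ³`, with `‖E‖² = ∫ |E(x)|² dx`. -/
abbrev L2Field : Type := Lp R3 2 (volume : Measure R3)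

/-- The real number `‖f‖_{L^p}` (meaningful for `f ∈ L^p`). -/
def lpNorm {F : Type*} [NormedAddCommGroup F] (p : ℝ≥0∞) (f : R3 → F) : ℝ :=
  (eLpNorm f p volume).toReal

/-! ### Fourier transform in the velocity -/

/-- `(𝓕_{v → η} f)(η) = (2π)^{-3/2} ∫ f(v) e^{-i v·η} dv`. -/
def fourierV (f : R3 → ℂ) (η : R3) : ℂ :=
  (((2 * Real.pi) ^ (-(3 / 2) : ℝ) : ℝ) : ℂ) *
    ∫ v : R3, f v * Complex.exp (-(Complex.I * ((inner ℝ v η : ℝ) : ℂ)))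

/-- `(𝓕⁻¹_{η → v} g)(v) = (2π)^{-3/2} ∫ g(η) e^{i v·η} dη`. -/
def invFourierV (g : R3 → ℂ) (v : R3) : ℂ :=
  (((2 * Real.pi) ^ (-(3 / 2) : ℝ) : ℝ) : ℂ) *
    ∫ η : R3, g η * Complex.exp (Complex.I * ((inner ℝ v η : ℝ) : ℂ))

/-! ### The pseudo-differential operators -/

/-- `W(x, η) = ∫_{-1/2}^{1/2} E(x - r η) dr`, where `E = ∇V`. -/
def meanField (E : R3 → R3) (x η : R3) : R3 :=
  ∫ r in (-(1 / 2) : ℝ)..(1 / 2), E (x - r • η)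

/-- `δV(x, η) = V(x + η/2) - V(x - η/2)`, the line integral of `E = ∇V` along the segment,
that is `η · W(x, η)`. -/
def deltaV (E : R3 → R3) (x η : R3) : ℝ := inner ℝ η (meanField E x η)

/-- `Γ_k[E] ψ = 𝓕⁻¹_{η → v} (W_k(x, η) 𝓕_{v → η} ψ)`. -/
def gammaOp (E : R3 → R3) (k : Fin 3) (ψ : R3 → R3 → ℂ) (x v : R3) : ℂ :=
  invFourierV (fun η => ((meanField E x η k : ℝ) : ℂ) * fourierV (ψ x) η) v

/-- `Θ[V] ψ = 𝓕⁻¹_{η → v} (i δV(x, η) 𝓕_{v → η} ψ)`, where `∇V = E`. -/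
def thetaOp (E : R3 → R3) (ψ : R3 → R3 → ℂ) (x v : R3) : ℂ :=
  invFourierV (fun η => Complex.I * ((deltaV E x η : ℝ) : ℂ) * fourierV (ψ x) η) v

/-- The pairing `⟨Γ_k[E] u, ψ⟩ = ∫∫ (Γ_k[E] u) ψ dx dv` for `u ∈ L²`, `E ∈ L²` and smooth `ψ`.
Since `W(x, ·)` is even, `Γ_k[E]` is symmetric for this bilinear pairing, and the operator
is let act on `ψ`. -/
def gammaPair (E : R3 → R3) (k : Fin 3) (u : Phase → ℝ) (ψ : R3 → R3 → ℂ) : ℂ :=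
  ∫ p : Phase, ((u p : ℝ) : ℂ) * gammaOp E k ψ p.1 p.2

/-- The pairing `⟨Θ[V] u, ψ⟩ = ∫∫ (Θ[V] u) ψ dx dv` for `u ∈ L²`, `∇V = E ∈ L²` and smooth `ψ`.
Since `δV(x, ·)` is odd, `Θ[V]` is skew-symmetric for this bilinear pairing, and the operator
is let act on `ψ`. -/
def thetaPair (E : R3 → R3) (u : Phase → ℝ) (ψ : R3 → R3 → ℂ) : ℂ :=
  -∫ p : Phase, ((u p : ℝ) : ℂ) * thetaOp E ψ p.1 p.2

/-! ### Densities and fields -/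

/-- The kernel `λ z / |z|³`, `λ = 1 / (4π)`. -/
def coulomb (z : R3) : R3 := (1 / (4 * Real.pi) * (‖z‖ ^ 3)⁻¹) • z

/-- The field `λ x/|x|³ ∗ n` of a density `n`. -/
def coulombField (n : R3 → ℝ) (x : R3) : R3 := ∫ y : R3, n y • coulomb (x - y)

/-- `∫ u(x - t v, v) dv`, the density of the freely transported `u`. -/
def freeDensity (u : Phase → ℝ) (t : ℝ) (x : R3) : ℝ := ∫ v : R3, u (x - t • v, v)

/-- `E₀(·, t) = λ x/|x|³ ∗ ∫ w₀(x - t v, v) dv`. -/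
def field0 (w0 : Phase → ℝ) (t : ℝ) : R3 → R3 := coulombField (freeDensity w0 t)

/-- Condition (B) on `(0, T]` with exponent `ω` and constant `K`: for `0 < t ≤ T` the integral
`∫ w₀(x - t v, v) dv` exists for almost every `x`, and its `L^{6/5}` norm is at most `K t^{-ω}`. -/
structure ConditionB (ω T K : ℝ) (w0 : Phase → ℝ) : Prop where
  integrable : ∀ t ∈ Ioc 0 T, ∀ᵐ x : R3, Integrable (fun v : R3 => w0 (x - t • v, v))
  memLp : ∀ t ∈ Ioc 0 T, MemLp (freeDensity w0 t) (6 / 5) volume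
  bound : ∀ t ∈ Ioc 0 T, lpNorm (6 / 5) (freeDensity w0 t) ≤ K * t ^ (-ω)

/-- The vector field `F ∈ L²` is
`F_k(x) = ∫₀ᵗ s ∫ (Γ_k[E(t - s)] w(t - s))(x - s v, v) dv ds`, as a tempered distribution in `x`:
`(x, v) ↦ (x - s v, v)` is moved to the test function. -/
def IsFlux (w : ℝ → L2Phase) (E : ℝ → R3 → R3) (t : ℝ) (F : L2Field) : Prop :=
  ∀ (φ : 𝓢(R3, ℝ)) (k : Fin 3),
    IntervalIntegrable (fun s : ℝ => (s : ℂ) *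
      gammaPair (E (t - s)) k (w (t - s)) (fun x v => ((φ (x + s • v) : ℝ) : ℂ))) volume 0 t ∧
    ((∫ x, F x k * φ x : ℝ) : ℂ) = ∫ s in (0 : ℝ)..t, (s : ℂ) *
      gammaPair (E (t - s)) k (w (t - s)) (fun x v => ((φ (x + s • v) : ℝ) : ℂ))

/-- The vector field `G ∈ L²` is `G_j = λ x_j/|x|³ ∗ div F`, `F ∈ L²`, as a tempered distribution:
as `x_j/|x|³` is odd, `⟨λ x_j/|x|³ ∗ ∂_k F_k, φ⟩ = ⟨F_k, λ x_j/|x|³ ∗ ∂_k φ⟩`. -/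
def IsCoulombDiv (F G : L2Field) : Prop :=
  ∀ (φ : 𝓢(R3, ℝ)) (j : Fin 3),
    ∫ x, G x j * φ x = ∑ k : Fin 3, ∫ y, F y k *
      coulombField (fun x => fderiv ℝ φ x (EuclideanSpace.single k 1)) y j

/-- The self-consistent field `E(t) = E₀(t) + E₁(t)` of a solution with initial value `w(0)`. -/
def totalField (w : ℝ → L2Phase) (E1 : ℝ → L2Field) (t : ℝ) (x : R3) : R3 :=
  field0 (w 0) t x + E1 t x

/-- `w ∈ C([0,T]; L²)` is a mild solution of the Wigner–Poisson equation
`w_t + v·∇ₓw = Θ[V] w` with self-consistent field `∇V = E₀ + E₁`.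
Here `E₀` is the field of the density `n₀ = ∫ w(0)(x - t v, v) dv` and `E₁` the field of
`n₁ = ∫₀ᵗ ∫ (Θ[V] w)(x - s v, v, t - s) dv ds = divₓ ∫₀ᵗ s ∫ (Γ[∇V] w)(x - s v, v, t - s) dv ds`,
where `n[w] = n₀ + n₁` is the density, so that `E₁` solves a linear Volterra equation. Duhamel's
formula is understood in the sense of tempered distributions on phase space. -/
structure IsMildSolution (T : ℝ) (w : ℝ → L2Phase) (E1 : ℝ → L2Field) : Prop where
  continuousOn : ContinuousOn w (Icc 0 T)
  field_continuousOn : ContinuousOn E1 (Ioc 0 T)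
  field_integrableOn : IntegrableOn (fun t => ‖E1 t‖) (Ioc 0 T)
  field_eq : ∀ t ∈ Ioc 0 T, ∃ F : L2Field,
    IsFlux w (totalField w E1) t F ∧ IsCoulombDiv F (E1 t)
  duhamel : ∀ t ∈ Icc 0 T, ∀ ψ : 𝓢(Phase, ℝ),
    IntervalIntegrable (fun s : ℝ => thetaPair (totalField w E1 (t - s)) (w (t - s))
      (fun x v => ((ψ (x + s • v, v) : ℝ) : ℂ))) volume 0 t ∧
    ((∫ p : Phase, w t p * ψ p : ℝ) : ℂ) =
      ((∫ p : Phase, w 0 (p.1 - t • p.2, p.2) * ψ p : ℝ) : ℂ) +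
        ∫ s in (0 : ℝ)..t, thetaPair (totalField w E1 (t - s)) (w (t - s))
          (fun x v => ((ψ (x + s • v, v) : ℝ) : ℂ))

end WP

end

noncomputable section

namespace WP

open Filter Topology LineDeriv
open scoped FourierTransform

/-! Both bounds are `L²` estimates for Coulomb fields.

For `E₀`, the kernel is dominated by `|z|⁻²`, and convolution with `|z|⁻²` maps `L^{6/5}(ℝ³)` to
`L²` by Hardy–Littlewood–Sobolev (`lintegral_riesz_potential_sq_le`). Expanding the square and using
`|z|⁻² ∗ |z|⁻² ≤ C |z|⁻¹` leaves the double integral of `g(x) g(y) / |x - y|`. By symmetry only the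
region `g(y) ≤ g(x)` matters, and there a near/far splitting with the optimal radius suffices.

For `E₁`, the flux is paired with a Schwartz function `φ`. Plancherel in the velocity and Jensen for
the line average `W` give `‖Γ_k[E]ψ‖₂ ≤ s^{-3/2} ‖E‖₂ ‖φ‖₂` for `ψ(x, v) = φ(x + s v)`
(`lintegral_gammaOp_sq_le`). With the weight `s` and the conserved norm of `w`, the flux is bounded
in `L²` through the Abel kernel `s^{-1/2}`. Divergence followed by the Coulomb kernel is a matrix of
second-order Riesz transforms, with multipliers `ξ_j ξ_k / |ξ|²`; they are contractions of `L²`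
(`eLpNorm_coulombField_partialDeriv_le`), which is shown by writing the kernel as a superposition of
Gaussians.

Hence `‖E₁(t)‖ ≤ 9 ‖w₀‖ ∫₀ᵗ (t - r)^{-1/2} (a r^{-ω} + ‖E₁(r)‖) dr`, where `a r^{-ω}` bounds
`‖E₀(r)‖`. One iteration replaces the Abel kernel acting on `‖E₁‖` by a bounded one, and Grönwall
closes the estimate (`le_of_volterra`). The power `t^{1/2-ω}` is that of the Beta integral of `(t -
r)^{-1/2} r^{-ω}`. -/

lemma finrank_R3 : Module.finrank ℝ R3 = 3 := by simp [R3]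

/-! ### Radial integrals of Riesz kernels. -/

/-- The area `3 |B₁|` of the unit sphere. -/
def sphereArea : ℝ := 3 * (volume : Measure R3).real (Metric.ball 0 1)

lemma sphereArea_pos : 0 < sphereArea := by
  have : 0 < (volume : Measure R3).real (Metric.ball 0 1) :=
    ENNReal.toReal_pos (Metric.measure_ball_pos _ _ one_pos).ne' measure_ball_lt_top.ne
  unfold sphereArea; positivity

lemma lintegral_radial {f : ℝ → ℝ} (hf0 : ∀ y, 0 ≤ f y)
    (hf : IntegrableOn (fun y : ℝ => y ^ 2 * f y) (Ioi 0)) :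
    ∫⁻ z : R3, ENNReal.ofReal (f ‖z‖)
      = ENNReal.ofReal (sphereArea * ∫ y in Ioi (0 : ℝ), y ^ 2 * f y) := by
  have hi : Integrable (fun z : R3 => f ‖z‖) := by
    rw [integrable_fun_norm_addHaar, finrank_R3]; simpa using hf
  rw [← ofReal_integral_eq_lintegral_ofReal hi (ae_of_all _ fun _ => hf0 _),
    integral_fun_norm_addHaar, finrank_R3]
  simp [sphereArea, mul_assoc]

/-- The Riesz kernel `|z|^{-a}`. -/
def riesz (a : ℝ) (z : R3) : ℝ≥0∞ := ENNReal.ofReal (‖z‖ ^ (-a))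

@[fun_prop]
lemma measurable_riesz (a : ℝ) : Measurable (riesz a) := by
  unfold riesz; fun_prop

lemma riesz_neg (a : ℝ) (z : R3) : riesz a (-z) = riesz a z := by simp [riesz]

lemma riesz_sub_comm (a : ℝ) (x y : R3) : riesz a (x - y) = riesz a (y - x) := by
  rw [← riesz_neg, neg_sub]

lemma setLIntegral_ball_riesz {a R : ℝ} (ha : a < 3) (hR : 0 < R) :
    ∫⁻ z in Metric.ball (0 : R3) R, riesz a z
      = ENNReal.ofReal (sphereArea * (R ^ (3 - a) / (3 - a))) := by
  have key : EqOn (fun y : ℝ => y ^ 2 * (Iio R).indicator (fun y => y ^ (-a)) y)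
      ((Iio R).indicator fun y => y ^ (2 - a)) (Ioi 0) := by
    intro y hy
    by_cases h : y ∈ Iio R
    · simp only [indicator_of_mem h]
      rw [← Real.rpow_natCast, ← Real.rpow_add hy]; norm_num [sub_eq_add_neg]
    · simp [indicator_of_notMem h]
  have hint : IntegrableOn (fun y : ℝ => y ^ (2 - a)) (Ioo 0 R) :=
    (intervalIntegral.integrableOn_Ioo_rpow_iff hR).2 (by linarith)
  -- The absolute value makes the radial profile nonnegative on all of `ℝ`; a real power of a
  -- negative number can be negative.
  have h := lintegral_radial (f := (Iio R).indicator fun y => |y| ^ (-a)) (fun y => by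
      refine indicator_nonneg (fun y _ => by positivity) y) ?_
  · rw [← lintegral_indicator measurableSet_ball]
    convert h using 2
    · ext z
      by_cases hz : z ∈ Metric.ball (0 : R3) R
      · have : ‖z‖ ∈ Iio R := by simpa using hz
        simp [indicator_of_mem hz, indicator_of_mem this, riesz]
      · have : ‖z‖ ∉ Iio R := by simpa using hz
        simp [indicator_of_notMem hz, indicator_of_notMem this]
    · congr 2
      rw [setIntegral_congr_fun (g := (Iio R).indicator fun y => y ^ (2 - a)) measurableSet_Ioi,
        setIntegral_indicator measurableSet_Iio, Ioi_inter_Iio,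
        ← integral_Ioc_eq_integral_Ioo, ← intervalIntegral.integral_of_le hR.le,
        integral_rpow (Or.inl (by linarith)), Real.zero_rpow (by linarith)]
      · ring_nf
      · intro y hy
        rw [← key hy]
        by_cases h : y ∈ Iio R
        · simp [indicator_of_mem h, abs_of_pos (show 0 < y from hy)]
        · simp [indicator_of_notMem h]
  · refine IntegrableOn.congr_fun (f := (Iio R).indicator fun y => y ^ (2 - a)) ?_ ?_
      measurableSet_Ioi
    · rw [integrableOn_indicator_iff measurableSet_Iio, inter_comm, Ioi_inter_Iio]
      exact hint
    · intro y hy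
      rw [← key hy]
      by_cases h : y ∈ Iio R
      · simp [indicator_of_mem h, abs_of_pos (show 0 < y from hy)]
      · simp [indicator_of_notMem h]

lemma setLIntegral_compl_ball_riesz {a R : ℝ} (ha : 3 < a) (hR : 0 < R) :
    ∫⁻ z in (Metric.ball (0 : R3) R)ᶜ, riesz a z
      = ENNReal.ofReal (sphereArea * (R ^ (3 - a) / (a - 3))) := by
  have key : EqOn (fun y : ℝ => y ^ 2 * (Ici R).indicator (fun y => |y| ^ (-a)) y)
      ((Ici R).indicator fun y => y ^ (2 - a)) (Ioi 0) := by
    intro y hy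
    by_cases h : y ∈ Ici R
    · simp only [indicator_of_mem h]
      rw [abs_of_pos (show 0 < y from hy), ← Real.rpow_natCast, ← Real.rpow_add hy]
      norm_num [sub_eq_add_neg]
    · simp [indicator_of_notMem h]
  have hs : Ioi (0 : ℝ) ∩ Ici R = Ici R := by
    apply inter_eq_right.2; intro y hy; exact hR.trans_le hy
  have h := lintegral_radial (f := (Ici R).indicator fun y => |y| ^ (-a)) (fun y => by
      refine indicator_nonneg (fun y _ => by positivity) y) ?_
  · rw [← lintegral_indicator measurableSet_ball.compl]
    convert h using 2
    · ext z
      by_cases hz : z ∈ Metric.ball (0 : R3) R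
      · have : ‖z‖ ∉ Ici R := by simpa using hz
        rw [indicator_of_notMem (by simpa using hz), indicator_of_notMem this]; simp
      · have : ‖z‖ ∈ Ici R := by simpa using hz
        rw [indicator_of_mem (by simpa using hz), indicator_of_mem this]; simp [riesz]
    · congr 2
      rw [setIntegral_congr_fun measurableSet_Ioi key,
        setIntegral_indicator measurableSet_Ici, hs, integral_Ici_eq_integral_Ioi,
        integral_Ioi_rpow_of_lt (by linarith) hR]
      rw [show 2 - a + 1 = -(a - 3) by ring, show (3 : ℝ) - a = -(a-3) by ring, div_neg, neg_div,
        neg_neg]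
  · refine IntegrableOn.congr_fun (f := (Ici R).indicator fun y => y ^ (2 - a)) ?_ key.symm
      measurableSet_Ioi
    rw [integrableOn_indicator_iff measurableSet_Ici, inter_comm, hs]
    rw [integrableOn_Ici_iff_integrableOn_Ioi]
    exact integrableOn_Ioi_rpow_of_lt (by linarith) hR

lemma riesz_rpow {a p : ℝ} (hp : 0 ≤ p) (z : R3) : riesz a z ^ p = riesz (a * p) z := by
  rw [riesz, riesz, ENNReal.ofReal_rpow_of_nonneg (by positivity) hp,
    ← Real.rpow_mul (norm_nonneg _), neg_mul]

lemma riesz_le_of_le {a r : ℝ} (ha : 0 ≤ a) (hr : 0 < r) {z : R3} (hz : r ≤ ‖z‖) :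
    riesz a z ≤ ENNReal.ofReal (r ^ (-a)) :=
  ENNReal.ofReal_le_ofReal (Real.rpow_le_rpow_of_nonpos hr hz (by linarith))

/-! ### The Hardy–Littlewood–Sobolev inequality. -/

/-- `|z|^{-2} ∗ |z|^{-2} ≤ C |z|^{-1}`. -/
lemma lintegral_riesz_two_mul_le :
    ∃ C : ℝ, 0 < C ∧ ∀ u : R3, u ≠ 0 →
      ∫⁻ z : R3, riesz 2 z * riesz 2 (u - z) ≤ ENNReal.ofReal C * riesz 1 u := by
  have hS := sphereArea_pos
  -- With `R = |u|/2` and `σ` the sphere area, the two near parts give `2 R⁻² · σ R` and the far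
  -- parts `2 σ R⁻¹`, in total `4 σ / R = 8 σ / |u|`.
  refine ⟨8 * sphereArea, by positivity, fun u hu => ?_⟩
  set R : ℝ := ‖u‖ / 2 with hR
  have hu' : 0 < ‖u‖ := norm_pos_iff.2 hu
  have hR0 : 0 < R := by positivity
  let B : Set R3 := Metric.ball 0 R
  let f : R3 → ℝ≥0∞ := B.indicator (riesz 2)
  let g : R3 → ℝ≥0∞ := Bᶜ.indicator (riesz 4)
  have hf : Measurable f := (measurable_riesz 2).indicator measurableSet_ball
  have hg : Measurable g := (measurable_riesz 4).indicator measurableSet_ball.compl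
  let c := ENNReal.ofReal (R ^ (-2 : ℝ))
  have hpt : ∀ z : R3, riesz 2 z * riesz 2 (u - z) ≤ c * f z + c * f (u - z) +
      (g z + g (u - z)) := by
    have far : ∀ z : R3, ‖z‖ < R → R ≤ ‖u - z‖ := fun z hz => by
      have := norm_sub_norm_le u z
      linarith
    intro z
    by_cases h1 : ‖z‖ < R
    · have hz : z ∈ B := by simpa [B] using h1
      refine le_trans ?_ (le_trans le_self_add le_self_add)
      simp only [f, indicator_of_mem hz]
      rw [mul_comm]
      gcongr
      exact riesz_le_of_le zero_le_two hR0 (far z h1)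
    by_cases h2 : ‖u - z‖ < R
    · have hz : u - z ∈ B := by simpa [B] using h2
      refine le_trans ?_ (le_trans le_add_self le_self_add)
      simp only [f, indicator_of_mem hz]
      gcongr
      exact riesz_le_of_le zero_le_two hR0 (not_lt.1 h1)
    -- Away from both singularities the product is at most the square of its larger factor, which is
    -- `|z|⁻⁴` or `|u - z|⁻⁴` and thus integrable at infinity.
    · have hz1 : z ∈ Bᶜ := by simpa [B] using h1
      have hz2 : u - z ∈ Bᶜ := by simpa [B] using h2
      refine le_trans ?_ le_add_self
      simp only [g, indicator_of_mem hz1, indicator_of_mem hz2]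
      have h4 : ∀ y, riesz 4 y = riesz 2 y * riesz 2 y := fun y => by
        have := riesz_rpow (a := 2) (p := 2) zero_le_two y
        norm_num at this
        rw [← this, sq]
      rw [h4, h4]
      rcases le_total (riesz 2 z) (riesz 2 (u - z)) with h | h
      · exact le_trans (by gcongr) le_add_self
      · exact le_trans (by gcongr) le_self_add
  have hsub : ∀ h : R3 → ℝ≥0∞, ∫⁻ z, h (u - z) = ∫⁻ z, h z := fun h =>
    lintegral_sub_left_eq_self h u
  have hfI : ∫⁻ z, f z = ENNReal.ofReal (sphereArea * R) := by
    simp only [f, B]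
    rw [lintegral_indicator measurableSet_ball, setLIntegral_ball_riesz (by norm_num) hR0]
    norm_num
  have hgI : ∫⁻ z, g z = ENNReal.ofReal (sphereArea * R⁻¹) := by
    simp only [g, B]
    rw [lintegral_indicator measurableSet_ball.compl,
      setLIntegral_compl_ball_riesz (by norm_num) hR0]
    norm_num [Real.rpow_neg_one]
  calc ∫⁻ z : R3, riesz 2 z * riesz 2 (u - z)
      ≤ ∫⁻ z, (c * f z + c * f (u - z) + (g z + g (u - z))) := lintegral_mono hpt
    _ = c * ENNReal.ofReal (sphereArea * R) + c * ENNReal.ofReal (sphereArea * R)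
        + (ENNReal.ofReal (sphereArea * R⁻¹) + ENNReal.ofReal (sphereArea * R⁻¹)) := by
      have hf' : Measurable fun z => f (u - z) := by fun_prop
      have hg' : Measurable fun z => g (u - z) := by fun_prop
      rw [lintegral_add_left (by fun_prop), lintegral_add_left (by fun_prop),
        lintegral_add_left (by fun_prop), lintegral_const_mul _ hf, lintegral_const_mul _ hf',
        hsub f, hsub g, hfI, hgI]
    _ ≤ ENNReal.ofReal (8 * sphereArea) * riesz 1 u := by
      simp only [c, riesz]
      rw [← ENNReal.ofReal_mul (by positivity), ← ENNReal.ofReal_mul (by positivity),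
        ← ENNReal.ofReal_add (by positivity) (by positivity),
        ← ENNReal.ofReal_add (by positivity) (by positivity),
        ← ENNReal.ofReal_add (by positivity) (by positivity)]
      apply ENNReal.ofReal_le_ofReal
      rw [Real.rpow_neg hR0.le, Real.rpow_neg hu'.le, Real.rpow_one, hR]
      norm_num
      apply le_of_eq
      field_simp
      norm_num

variable {g : R3 → ℝ}

/-- The near/far splitting at radius `R` of the Riesz potential of a density bounded by `a`. -/
lemma lintegral_truncated_riesz_one_le (hg : Measurable g) {a R : ℝ} (ha : 0 < a)
    (hR : 0 < R) (x : R3) :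
    ∫⁻ y, {y | g y ≤ a}.indicator (fun y => ENNReal.ofReal (g y) * riesz 1 (x - y)) y
      ≤ ENNReal.ofReal (a * (sphereArea * (R ^ (2 : ℝ) / 2))) +
        (∫⁻ y, ENNReal.ofReal (g y) ^ (6 / 5 : ℝ)) ^ (5 / 6 : ℝ) *
          ENNReal.ofReal (sphereArea * (R ^ (-3 : ℝ) / 3)) ^ (1 / 6 : ℝ) := by
  let B : Set R3 := Metric.ball 0 R
  let k : R3 → ℝ≥0∞ := B.indicator (riesz 1)
  let l : R3 → ℝ≥0∞ := Bᶜ.indicator (riesz 1)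
  have hk : Measurable k := (measurable_riesz 1).indicator measurableSet_ball
  have hl : Measurable l := (measurable_riesz 1).indicator measurableSet_ball.compl
  have hpt : ∀ y, {y | g y ≤ a}.indicator (fun y => ENNReal.ofReal (g y) * riesz 1 (x - y)) y
      ≤ ENNReal.ofReal a * k (x - y) + ENNReal.ofReal (g y) * l (x - y) := by
    intro y
    by_cases h : g y ≤ a
    · rw [indicator_of_mem (show y ∈ {y | g y ≤ a} from h)]
      by_cases hB : x - y ∈ B
      · refine le_trans ?_ le_self_add
        simp only [k, indicator_of_mem hB]
        gcongr
      · refine le_trans ?_ le_add_self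
        simp only [l, indicator_of_mem (show x - y ∈ Bᶜ from hB)]
        exact le_rfl
    · rw [indicator_of_notMem (show y ∉ {y | g y ≤ a} from h)]
      exact zero_le
  have hsub : ∀ h : R3 → ℝ≥0∞, ∫⁻ z, h (x - z) = ∫⁻ z, h z := fun h =>
    lintegral_sub_left_eq_self h x
  refine (lintegral_mono hpt).trans ?_
  rw [lintegral_add_left (by fun_prop), lintegral_const_mul _ (by fun_prop), hsub k]
  gcongr
  · simp only [k, B]
    rw [lintegral_indicator measurableSet_ball, setLIntegral_ball_riesz (by norm_num) hR,
      ← ENNReal.ofReal_mul ha.le]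
    norm_num
  -- The far part is handled by Hölder: `|z|⁻¹` is in `L⁶` outside a ball.
  · have hpq : Real.HolderConjugate (6 / 5) 6 := by
      rw [Real.holderConjugate_iff]; norm_num
    refine (ENNReal.lintegral_mul_le_Lp_mul_Lq volume hpq (f := fun y => ENNReal.ofReal (g y))
      (g := fun y => l (x - y)) (by fun_prop) (by fun_prop)).trans ?_
    rw [show (1 : ℝ) / (6 / 5) = 5 / 6 by norm_num]
    gcongr
    rw [hsub fun z => l z ^ (6 : ℝ)]
    have : ∀ z, l z ^ (6 : ℝ) = Bᶜ.indicator (riesz 6) z := by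
      intro z
      by_cases hz : z ∈ Bᶜ
      · simp only [l, indicator_of_mem hz]
        rw [riesz_rpow (by norm_num)]; norm_num
      · simp only [l, indicator_of_notMem hz]; simp
    simp only [this, B]
    rw [lintegral_indicator measurableSet_ball.compl,
      setLIntegral_compl_ball_riesz (by norm_num) hR]
    norm_num

/-- The bound of the truncated Riesz potential with the optimal radius. -/
lemma lintegral_truncated_riesz_one_le_rpow (hg : Measurable g) {n : ℝ} (hn : 0 < n)
    (hgn : ∫⁻ y, ENNReal.ofReal (g y) ^ (6 / 5 : ℝ) = ENNReal.ofReal n) {a : ℝ} (ha : 0 < a)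
    (x : R3) :
    ∫⁻ y, {y | g y ≤ a}.indicator (fun y => ENNReal.ofReal (g y) * riesz 1 (x - y)) y
      ≤ ENNReal.ofReal ((sphereArea / 2 + (sphereArea / 3) ^ (1 / 6 : ℝ)) *
        n ^ (2 / 3 : ℝ)) * ENNReal.ofReal a ^ (1 / 5 : ℝ) := by
  have hS := sphereArea_pos
  -- This radius balances the near term, of order `a R²`, against the far term, of order `n^{5/6}
  -- R^{-1/2}`.
  set R : ℝ := n ^ (1 / 3 : ℝ) * a ^ (-(2 / 5) : ℝ) with hR
  have hR0 : 0 < R := by positivity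
  refine (lintegral_truncated_riesz_one_le hg ha hR0 x).trans ?_
  rw [hgn, ENNReal.ofReal_rpow_of_pos hn, ENNReal.ofReal_rpow_of_pos (by positivity),
    ENNReal.ofReal_rpow_of_pos ha, ← ENNReal.ofReal_mul (by positivity),
    ← ENNReal.ofReal_mul (by positivity), ← ENNReal.ofReal_add (by positivity) (by positivity)]
  apply ENNReal.ofReal_le_ofReal
  have e1 : a * R ^ (2 : ℝ) = n ^ (2 / 3 : ℝ) * a ^ (1 / 5 : ℝ) := by
    rw [hR, Real.mul_rpow (by positivity) (by positivity), ← Real.rpow_mul hn.le,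
      ← Real.rpow_mul ha.le]
    nth_rewrite 1 [← Real.rpow_one a]
    rw [mul_left_comm, ← Real.rpow_add ha]
    norm_num
  have e2 : n ^ (5 / 6 : ℝ) * (R ^ (-3 : ℝ)) ^ (1 / 6 : ℝ) = n ^ (2 / 3 : ℝ) * a ^ (1 / 5 : ℝ) := by
    rw [← Real.rpow_mul hR0.le, hR, Real.mul_rpow (by positivity) (by positivity),
      ← Real.rpow_mul hn.le, ← Real.rpow_mul ha.le, ← mul_assoc, ← Real.rpow_add hn]
    norm_num
  have e3 : (sphereArea * (R ^ (-3 : ℝ) / 3)) ^ (1 / 6 : ℝ)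
      = (sphereArea / 3) ^ (1 / 6 : ℝ) * (R ^ (-3 : ℝ)) ^ (1 / 6 : ℝ) := by
    rw [← Real.mul_rpow (by positivity) (by positivity)]; ring_nf
  rw [e3]
  apply le_of_eq
  calc _ = sphereArea / 2 * (a * R ^ (2 : ℝ)) + (sphereArea / 3) ^ (1 / 6 : ℝ) *
        (n ^ (5 / 6 : ℝ) * (R ^ (-3 : ℝ)) ^ (1 / 6 : ℝ)) := by ring
    _ = _ := by rw [e1, e2]; ring

/-- The diagonal Hardy–Littlewood–Sobolev inequality in `ℝ³` with kernel `|z|⁻¹`. -/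
lemma lintegral_lintegral_riesz_one_le :
    ∃ C : ℝ, 0 < C ∧ ∀ g : R3 → ℝ, Measurable g →
      ∫⁻ x, ∫⁻ y, ENNReal.ofReal (g x) * (ENNReal.ofReal (g y) * riesz 1 (x - y))
        ≤ ENNReal.ofReal C * (∫⁻ y, ENNReal.ofReal (g y) ^ (6 / 5 : ℝ)) ^ (5 / 3 : ℝ) := by
  have hS := sphereArea_pos
  set D := sphereArea / 2 + (sphereArea / 3) ^ (1 / 6 : ℝ) with hD
  have hD0 : 0 < D := by positivity
  refine ⟨2 * D, by positivity, fun g hg => ?_⟩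
  set N := ∫⁻ y, ENNReal.ofReal (g y) ^ (6 / 5 : ℝ) with hN
  rcases eq_or_ne N ⊤ with h | h
  · rw [h, ENNReal.top_rpow_of_pos (by norm_num), ENNReal.mul_top (by simpa using hD0)]
    exact le_top
  rcases eq_or_ne N 0 with h0 | h0
  · have hz := (lintegral_eq_zero_iff (by fun_prop)).1 h0
    have : ∀ᵐ x, ∫⁻ y, ENNReal.ofReal (g x) * (ENNReal.ofReal (g y) * riesz 1 (x - y)) = 0 := by
      filter_upwards [hz] with x hx
      have : ENNReal.ofReal (g x) = 0 := by
        rcases ENNReal.rpow_eq_zero_iff.1 hx with h | h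
        · exact h.1
        · exact absurd h.1 ENNReal.ofReal_ne_top
      simp [this]
    rw [lintegral_congr_ae this]
    simp
  have hn : 0 < N.toReal := ENNReal.toReal_pos h0 h
  -- The kernel is symmetric, so it suffices to integrate over `g y ≤ g x`. There the truncated
  -- bound at level `a = g x` contributes `g(x)^{1/5}`, which together with the outer `g(x)` is the
  -- `6/5`-th power whose integral is `N`; the remaining factor is `N^{2/3}`.
  let H : R3 → R3 → ℝ≥0∞ := fun x y =>
    ENNReal.ofReal (g x) * {y | g y ≤ g x}.indicator
      (fun y => ENNReal.ofReal (g y) * riesz 1 (x - y)) y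
  have hH : Measurable (Function.uncurry H) := by
    have : Function.uncurry H = {p : R3 × R3 | g p.2 ≤ g p.1}.indicator fun p =>
        ENNReal.ofReal (g p.1) * (ENNReal.ofReal (g p.2) * riesz 1 (p.1 - p.2)) := by
      ext ⟨x, y⟩
      by_cases hxy : g y ≤ g x <;> simp [H, indicator, hxy]
    rw [this]
    exact Measurable.indicator (by fun_prop)
      (measurableSet_le (hg.comp measurable_snd) (hg.comp measurable_fst))
  have hpt : ∀ x y, ENNReal.ofReal (g x) * (ENNReal.ofReal (g y) * riesz 1 (x - y))
      ≤ H x y + H y x := by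
    intro x y
    rcases le_total (g y) (g x) with hxy | hxy
    · refine le_trans (le_of_eq ?_) le_self_add
      simp [H, hxy]
    · refine le_trans (le_of_eq ?_) le_add_self
      simp only [H, indicator_of_mem (show x ∈ {z | g z ≤ g y} from hxy)]
      rw [riesz_sub_comm, mul_left_comm]
  have hone : ∫⁻ x, ∫⁻ y, H x y ≤ ENNReal.ofReal D * N ^ (5 / 3 : ℝ) := by
    calc ∫⁻ x, ∫⁻ y, H x y
        ≤ ∫⁻ x, ENNReal.ofReal (D * N.toReal ^ (2 / 3 : ℝ)) *
            ENNReal.ofReal (g x) ^ (6 / 5 : ℝ) := by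
          refine lintegral_mono fun x => ?_
          simp only [H]
          rcases le_or_gt (g x) 0 with hx | hx
          · simp [ENNReal.ofReal_of_nonpos hx]
          rw [lintegral_const_mul _ (Measurable.indicator (by fun_prop)
            (measurableSet_le hg measurable_const))]
          refine (mul_le_mul_right (lintegral_truncated_riesz_one_le_rpow hg hn
            (by rw [ENNReal.ofReal_toReal h]) hx x) _).trans (le_of_eq ?_)
          rw [mul_left_comm]
          congr 1
          nth_rewrite 1 [← ENNReal.rpow_one (ENNReal.ofReal (g x))]
          rw [← ENNReal.rpow_add _ _ (by simpa using hx) ENNReal.ofReal_ne_top]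
          norm_num
      _ = ENNReal.ofReal D * N ^ (5 / 3 : ℝ) := by
          rw [lintegral_const_mul _ (by fun_prop), ← hN, ENNReal.ofReal_mul hD0.le,
            ← ENNReal.ofReal_rpow_of_pos hn, ENNReal.ofReal_toReal h, mul_assoc]
          congr 1
          nth_rewrite 2 [← ENNReal.rpow_one N]
          rw [← ENNReal.rpow_add _ _ h0 h]
          norm_num
  calc _ ≤ ∫⁻ x, ∫⁻ y, (H x y + H y x) := lintegral_mono fun x => lintegral_mono fun y => hpt x y
    _ = (∫⁻ x, ∫⁻ y, H x y) + ∫⁻ x, ∫⁻ y, H y x := by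
      rw [← lintegral_add_left hH.lintegral_prod_right]
      refine lintegral_congr fun x => ?_
      exact lintegral_add_left (hH.comp measurable_prodMk_left) _
    _ = (∫⁻ x, ∫⁻ y, H x y) + ∫⁻ x, ∫⁻ y, H x y := by
      congr 1
      exact lintegral_lintegral_swap (f := fun x y => H y x) (hH.comp measurable_swap).aemeasurable
    _ ≤ _ := by
      refine (add_le_add hone hone).trans (le_of_eq ?_)
      rw [ENNReal.ofReal_mul zero_le_two, ← two_mul, mul_assoc]
      norm_num

/-- The Hardy–Littlewood–Sobolev inequality `‖ |z|⁻² ∗ |n| ‖₂ ≤ C ‖n‖_{6/5}` in `ℝ³`. -/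
lemma lintegral_riesz_potential_sq_le :
    ∃ C : ℝ, 0 < C ∧ ∀ g : R3 → ℝ, Measurable g →
      ∫⁻ z, (∫⁻ x, ENNReal.ofReal (g x) * riesz 2 (z - x)) ^ 2
        ≤ ENNReal.ofReal C * (∫⁻ y, ENNReal.ofReal (g y) ^ (6 / 5 : ℝ)) ^ (5 / 3 : ℝ) := by
  obtain ⟨C, hC, h⟩ := lintegral_riesz_two_mul_le
  obtain ⟨C', hC', h'⟩ := lintegral_lintegral_riesz_one_le
  refine ⟨C * C', by positivity, fun g hg => ?_⟩
  have hker : ∀ x y : R3, x ≠ y →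
      ∫⁻ z, riesz 2 (z - x) * riesz 2 (z - y) ≤ ENNReal.ofReal C * riesz 1 (x - y) := by
    intro x y hxy
    rw [riesz_sub_comm]
    refine le_trans (le_of_eq ?_) (h (y - x) (sub_ne_zero.2 hxy.symm))
    rw [← lintegral_sub_right_eq_self (fun z => riesz 2 z * riesz 2 (y - x - z)) x]
    refine lintegral_congr fun z => ?_
    rw [riesz_sub_comm 2 z y, sub_sub_sub_cancel_right]
  calc ∫⁻ z, (∫⁻ x, ENNReal.ofReal (g x) * riesz 2 (z - x)) ^ 2
      = ∫⁻ z, ∫⁻ x, ∫⁻ y, ENNReal.ofReal (g x) * ENNReal.ofReal (g y) *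
          (riesz 2 (z - x) * riesz 2 (z - y)) := by
        refine lintegral_congr fun z => ?_
        rw [sq, ← lintegral_mul_const _ (by fun_prop)]
        refine lintegral_congr fun x => ?_
        rw [← lintegral_const_mul _ (by fun_prop)]
        refine lintegral_congr fun y => ?_
        ring
    _ = ∫⁻ x, ∫⁻ y, ∫⁻ z, ENNReal.ofReal (g x) * ENNReal.ofReal (g y) *
          (riesz 2 (z - x) * riesz 2 (z - y)) := by
        rw [lintegral_lintegral_swap]
        · refine lintegral_congr fun x => ?_
          rw [lintegral_lintegral_swap]
          fun_prop
        · refine Measurable.aemeasurable ?_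
          refine Measurable.lintegral_prod_right' (f := fun q : (R3 × R3) × R3 =>
            ENNReal.ofReal (g q.1.2) * ENNReal.ofReal (g q.2) *
              (riesz 2 (q.1.1 - q.1.2) * riesz 2 (q.1.1 - q.2))) ?_
          fun_prop
    _ ≤ ∫⁻ x, ∫⁻ y, ENNReal.ofReal C *
          (ENNReal.ofReal (g x) * (ENNReal.ofReal (g y) * riesz 1 (x - y))) := by
        refine lintegral_mono fun x => lintegral_mono_ae ?_
        -- The diagonal must be discarded: there the left side of `hker` is `∫ |z|⁻⁴ = ∞`, while
        -- `riesz 1 0 = 0` by the convention for real powers of zero.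
        have : ∀ᵐ y : R3, y ≠ x := by simp [ae_iff]
        filter_upwards [this] with y hy
        rw [lintegral_const_mul _ (by fun_prop)]
        calc _ ≤ ENNReal.ofReal (g x) * ENNReal.ofReal (g y) *
              (ENNReal.ofReal C * riesz 1 (x - y)) := by gcongr; exact hker x y hy.symm
          _ = _ := by ring
    _ ≤ _ := by
        have hm : Measurable fun x => ∫⁻ y,
            ENNReal.ofReal (g x) * (ENNReal.ofReal (g y) * riesz 1 (x - y)) := by
          refine Measurable.lintegral_prod_right' (f := fun q : R3 × R3 =>
            ENNReal.ofReal (g q.1) * (ENNReal.ofReal (g q.2) * riesz 1 (q.1 - q.2))) ?_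
          fun_prop
        rw [ENNReal.ofReal_mul hC.le, mul_assoc]
        refine le_trans (le_of_eq ?_) (mul_le_mul_right (h' g hg) _)
        rw [← lintegral_const_mul _ hm]
        refine lintegral_congr fun x => ?_
        rw [lintegral_const_mul _ (by fun_prop)]

/-! ### The Coulomb field of a density in `L^{6/5}`. -/

lemma norm_coulomb (z : R3) : ‖coulomb z‖ = 1 / (4 * Real.pi) * ‖z‖ ^ (-2 : ℝ) := by
  rw [coulomb, norm_smul, Real.norm_of_nonneg (by positivity), Real.rpow_neg (norm_nonneg _)]
  rcases eq_or_ne ‖z‖ 0 with h | h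
  · simp [h]
  · norm_num
    field_simp

lemma enorm_coulomb_le (z : R3) : ‖coulomb z‖ₑ ≤ riesz 2 z := by
  rw [← ofReal_norm, norm_coulomb]
  apply ENNReal.ofReal_le_ofReal
  apply mul_le_of_le_one_left (by positivity)
  rw [div_le_one (by positivity)]
  linarith [Real.pi_gt_three]

@[fun_prop]
lemma measurable_coulomb : Measurable coulomb := by
  unfold coulomb; fun_prop

lemma stronglyMeasurable_coulombField {n : R3 → ℝ} (hn : StronglyMeasurable n) :
    StronglyMeasurable (coulombField n) := by
  unfold coulombField
  apply StronglyMeasurable.integral_prod_right' (f := fun q : R3 × R3 => n q.2 • coulomb (q.1 - q.2))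
  exact (hn.comp_measurable measurable_snd).smul
    (measurable_coulomb.comp (measurable_fst.sub measurable_snd)).stronglyMeasurable

/-- The field of a density in `L^{6/5}` converges absolutely and is in `L²`. -/
lemma coulombField_memLp_two :
    ∃ C : ℝ, 0 < C ∧ ∀ n : R3 → ℝ, StronglyMeasurable n → MemLp n (6 / 5) volume →
      (∀ᵐ x : R3, Integrable fun y : R3 => n y • coulomb (x - y)) ∧
      MemLp (coulombField n) 2 volume ∧
      lpNorm 2 (coulombField n) ≤ C * lpNorm (6 / 5) n := by
  obtain ⟨C, hC, h⟩ := lintegral_riesz_potential_sq_le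
  refine ⟨C ^ (1 / 2 : ℝ), by positivity, fun n hn hLp => ?_⟩
  have hmeas := hn.measurable
  let I : R3 → ℝ≥0∞ := fun z => ∫⁻ x, ENNReal.ofReal ‖n x‖ * riesz 2 (z - x)
  have hI : Measurable I := by
    refine Measurable.lintegral_prod_right' (f := fun q : R3 × R3 =>
      ENNReal.ofReal ‖n q.2‖ * riesz 2 (q.1 - q.2)) ?_
    fun_prop
  have hp : ((6 / 5 : ℝ≥0∞)).toReal = 6 / 5 := by norm_num
  have hp0 : (6 / 5 : ℝ≥0∞) ≠ 0 := by simp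
  have hpt : (6 / 5 : ℝ≥0∞) ≠ ⊤ := ENNReal.div_ne_top (by simp) (by simp)
  have hN : (∫⁻ y, ENNReal.ofReal ‖n y‖ ^ (6 / 5 : ℝ)) ^ (5 / 3 : ℝ)
      = eLpNorm n (6 / 5) volume ^ 2 := by
    rw [eLpNorm_eq_lintegral_rpow_enorm_toReal hp0 hpt, hp, ← ENNReal.rpow_natCast,
      ← ENNReal.rpow_mul]
    simp only [ofReal_norm]
    norm_num
  have hI2 : ∫⁻ z, I z ^ 2 ≤ ENNReal.ofReal C * eLpNorm n (6 / 5) volume ^ 2 := by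
    rw [← hN]; exact h (fun x => ‖n x‖) (by fun_prop)
  have hpt' : ∀ x y, ‖n y • coulomb (x - y)‖ₑ ≤ ENNReal.ofReal ‖n y‖ * riesz 2 (x - y) := by
    intro x y
    rw [enorm_smul, ofReal_norm]
    gcongr
    exact enorm_coulomb_le _
  have hle : ∀ x, ‖coulombField n x‖ₑ ≤ I x := fun x =>
    (enorm_integral_le_lintegral_enorm _).trans (lintegral_mono (hpt' x))
  have hnorm : eLpNorm (coulombField n) 2 volume
      ≤ ENNReal.ofReal (C ^ (1 / 2 : ℝ)) * eLpNorm n (6 / 5) volume := by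
    rw [eLpNorm_eq_lintegral_rpow_enorm_toReal two_ne_zero ENNReal.ofNat_ne_top]
    calc _ ≤ (∫⁻ z, I z ^ 2) ^ (1 / 2 : ℝ) := by
          simp only [ENNReal.toReal_ofNat]
          gcongr with z
          rw [← ENNReal.rpow_two]
          gcongr
          exact hle z
      _ ≤ (ENNReal.ofReal C * eLpNorm n (6 / 5) volume ^ 2) ^ (1 / 2 : ℝ) := by gcongr
      _ = _ := by
          rw [ENNReal.mul_rpow_of_nonneg _ _ (by norm_num), ENNReal.ofReal_rpow_of_pos hC,
            ← ENNReal.rpow_two, ← ENNReal.rpow_mul]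
          norm_num
  have hfin : ENNReal.ofReal (C ^ (1 / 2 : ℝ)) * eLpNorm n (6 / 5) volume ≠ ⊤ :=
    ENNReal.mul_ne_top ENNReal.ofReal_ne_top hLp.eLpNorm_ne_top
  refine ⟨?_, ⟨(stronglyMeasurable_coulombField hn).aestronglyMeasurable,
    hnorm.trans_lt hfin.lt_top⟩, ?_⟩
  · have hfinI : ∫⁻ z, I z ^ 2 ≠ ⊤ := ne_top_of_le_ne_top
      (ENNReal.mul_ne_top ENNReal.ofReal_ne_top (ENNReal.pow_ne_top hLp.eLpNorm_ne_top)) hI2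
    filter_upwards [ae_lt_top (hI.pow_const 2) hfinI] with x hx
    refine ⟨((hn.smul (measurable_coulomb.comp
      (measurable_const.sub measurable_id)).stronglyMeasurable)).aestronglyMeasurable, ?_⟩
    have hx' : I x < ⊤ := by simpa using hx
    exact (lintegral_mono (hpt' x)).trans_lt hx'
  · unfold lpNorm
    have := ENNReal.toReal_mono hfin hnorm
    rwa [ENNReal.toReal_mul, ENNReal.toReal_ofReal (by positivity)] at this

lemma stronglyMeasurable_freeDensity {u : Phase → ℝ} (hu : StronglyMeasurable u) (t : ℝ) :
    StronglyMeasurable (freeDensity u t) := by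
  unfold freeDensity
  apply StronglyMeasurable.integral_prod_right' (f := fun q : R3 × R3 => u (q.1 - t • q.2, q.2))
  exact hu.comp_measurable (by fun_prop)

/-! ### Plancherel in the velocity variable. -/

/-- On `L¹ ∩ L²` the Fourier integral agrees with the `L²` Fourier transform. -/
lemma fourier_ae_eq_fourier_toLp {g : R3 → ℂ} (hg : Integrable g) (hg2 : MemLp g 2 volume) :
    𝓕 g =ᵐ[volume] (𝓕 (hg2.toLp g) : Lp ℂ 2 (volume : Measure R3)) := by
  have hcont : Continuous (𝓕 g) :=
    VectorFourier.fourierIntegral_continuous Real.continuous_fourierChar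
      (innerSL ℝ).continuous₂ hg
  -- Against a smooth compactly supported test function, both transforms can be moved onto the test
  -- function, with the same result.
  refine ae_eq_of_integral_contDiff_smul_eq hcont.locallyIntegrable
    ((Lp.memLp _).locallyIntegrable one_le_two) fun ψ hψ hψc => ?_
  let Ψ : 𝓢(R3, ℂ) := (hψc.comp_left (g := Complex.ofReal) rfl).toSchwartzMap
    (Complex.ofRealCLM.contDiff.comp hψ)
  have hΨ : ∀ x, Ψ x = (ψ x : ℂ) := fun x => rfl
  have h1 : ∫ x, ψ x • 𝓕 g x = ∫ x, 𝓕 (Ψ : R3 → ℂ) x * g x := by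
    have := VectorFourier.integral_fourierIntegral_smul_eq_flip (μ := volume) (ν := volume)
      (L := innerₗ R3) Real.continuous_fourierChar continuous_inner Ψ.integrable hg
    rw [flip_innerₗ] at this
    simp only [smul_eq_mul] at this
    refine Eq.trans ?_ this.symm
    refine integral_congr_ae (ae_of_all _ fun x => ?_)
    simp only [hΨ, Complex.real_smul]
    rfl
  have h2 : ∫ x, ψ x • (𝓕 (hg2.toLp g) : Lp ℂ 2 (volume : Measure R3)) x
      = ∫ x, 𝓕 (Ψ : R3 → ℂ) x * g x := by
    have h3 := DFunLike.congr_fun (Lp.fourier_toTemperedDistribution_eq (hg2.toLp g)) Ψ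
    rw [TemperedDistribution.fourier_apply, Lp.toTemperedDistribution_apply,
      Lp.toTemperedDistribution_apply] at h3
    simp only [smul_eq_mul] at h3
    refine Eq.trans ?_ (h3.symm.trans ?_)
    · refine integral_congr_ae (ae_of_all _ fun x => ?_)
      simp only [hΨ, Complex.real_smul]
    · refine integral_congr_ae ?_
      filter_upwards [hg2.coeFn_toLp] with x hx
      rw [hx, SchwartzMap.fourier_coe]
  rw [h1, h2]

lemma eLpNorm_two_sq_eq {α F : Type*} [MeasurableSpace α] {μ : Measure α} [NormedAddCommGroup F]
    (f : α → F) : eLpNorm f 2 μ ^ 2 = ∫⁻ x, ‖f x‖ₑ ^ 2 ∂μ := by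
  rw [eLpNorm_eq_lintegral_rpow_enorm_toReal two_ne_zero ENNReal.ofNat_ne_top,
    ← ENNReal.rpow_two, ← ENNReal.rpow_mul]
  simp

/-- Plancherel's inequality for the Fourier integral. -/
lemma lintegral_fourier_sq_le {g : R3 → ℂ} (hg : AEStronglyMeasurable g volume) :
    ∫⁻ w, ‖𝓕 g w‖ₑ ^ 2 ≤ ∫⁻ x, ‖g x‖ₑ ^ 2 := by
  -- No integrability is needed: if `g ∉ L¹` the Fourier integral is zero by convention, and if `g ∉
  -- L²` the right side is infinite.
  by_cases hi : Integrable g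
  · by_cases h2 : MemLp g 2 volume
    · rw [← eLpNorm_two_sq_eq, ← eLpNorm_two_sq_eq,
        eLpNorm_congr_ae (fourier_ae_eq_fourier_toLp hi h2), ← Lp.enorm_def,
        ← Lp.enorm_toLp h2, ← ofReal_norm, Lp.norm_fourier_eq, ofReal_norm]
    · have : eLpNorm g 2 volume = ⊤ := by
        by_contra h; exact h2 ⟨hg, lt_top_iff_ne_top.2 h⟩
      rw [← eLpNorm_two_sq_eq g, this]
      simp
  · have : ∀ w, 𝓕 g w = 0 := fun w => by
      rw [Real.fourier_eq]
      exact integral_undef (by rwa [Real.fourierIntegral_convergent_iff])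
    simp [this]

/-- Passage from the convention `e^{i v·η}` to `𝓕`, whose phase is `e^{-2πi v·η}`: the frequency is
rescaled by `-(2π)⁻¹`. -/
lemma invFourierV_eq (g : R3 → ℂ) (v : R3) :
    invFourierV g v = (((2 * Real.pi) ^ (-(3 / 2) : ℝ) : ℝ) : ℂ) * 𝓕 g (-(2 * Real.pi)⁻¹ • v) := by
  rw [invFourierV, Real.fourier_eq']
  congr 1
  refine integral_congr_ae (ae_of_all _ fun η => ?_)
  simp only [smul_eq_mul]
  rw [mul_comm, inner_smul_right, real_inner_comm]
  congr 2
  push_cast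
  have : (Real.pi : ℂ) ≠ 0 := by exact_mod_cast Real.pi_ne_zero
  field_simp

lemma fourierV_eq (g : R3 → ℂ) (v : R3) :
    fourierV g v = (((2 * Real.pi) ^ (-(3 / 2) : ℝ) : ℝ) : ℂ) * 𝓕 g ((2 * Real.pi)⁻¹ • v) := by
  rw [fourierV, Real.fourier_eq']
  congr 1
  refine integral_congr_ae (ae_of_all _ fun η => ?_)
  simp only [smul_eq_mul]
  rw [mul_comm, inner_smul_right]
  congr 2
  push_cast
  have : (Real.pi : ℂ) ≠ 0 := by exact_mod_cast Real.pi_ne_zero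
  field_simp

lemma lintegral_comp_smul_R3 (f : R3 → ℝ≥0∞) {r : ℝ} (hr : r ≠ 0) :
    ∫⁻ x, f (r • x) = ENNReal.ofReal (|r| ^ 3)⁻¹ * ∫⁻ x, f x := by
  have h := (Homeomorph.smulOfNeZero r hr : R3 ≃ₜ R3).toMeasurableEquiv.measurableEmbedding
    |>.lintegral_map (μ := volume) f
  have h2 : Measure.map (fun x : R3 => r • x) volume = ENNReal.ofReal (|r| ^ 3)⁻¹ • volume := by
    rw [Measure.map_addHaar_smul volume hr, finrank_R3, abs_inv, abs_pow]
  calc _ = ∫⁻ x, f x ∂(Measure.map (fun x : R3 => r • x) volume) := h.symm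
    _ = _ := by rw [h2, lintegral_smul_measure, smul_eq_mul]

/-- The square of the normalization `(2π)^{-3/2}` cancels the Jacobian `(2π)³` of the rescaled
frequency, which makes both velocity transforms contractions of `L²`. -/
lemma enorm_const_sq :
    ‖(((2 * Real.pi) ^ (-(3 / 2) : ℝ) : ℝ) : ℂ)‖ₑ ^ 2 * ENNReal.ofReal (((2 * Real.pi)⁻¹) ^ 3)⁻¹
      = 1 := by
  rw [← ofReal_norm, Complex.norm_real, Real.norm_of_nonneg (by positivity),
    ← ENNReal.ofReal_pow (by positivity), ← ENNReal.ofReal_mul (by positivity),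
    ← Real.rpow_natCast, ← Real.rpow_mul (by positivity)]
  norm_num
  field_simp

lemma lintegral_invFourierV_sq_le {g : R3 → ℂ} (hg : AEStronglyMeasurable g volume) :
    ∫⁻ v, ‖invFourierV g v‖ₑ ^ 2 ≤ ∫⁻ x, ‖g x‖ₑ ^ 2 := by
  have hπ : (-(2 * Real.pi)⁻¹) ≠ 0 := by
    simp [Real.pi_ne_zero]
  simp only [invFourierV_eq, enorm_mul, mul_pow]
  rw [lintegral_const_mul' _ _ (by simp), lintegral_comp_smul_R3 (fun w => ‖𝓕 g w‖ₑ ^ 2) hπ,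
    ← mul_assoc, abs_neg, abs_of_pos (by positivity), enorm_const_sq, one_mul]
  exact lintegral_fourier_sq_le hg

lemma lintegral_fourierV_sq_le {g : R3 → ℂ} (hg : AEStronglyMeasurable g volume) :
    ∫⁻ v, ‖fourierV g v‖ₑ ^ 2 ≤ ∫⁻ x, ‖g x‖ₑ ^ 2 := by
  have hπ : (2 * Real.pi)⁻¹ ≠ 0 := by
    simp [Real.pi_ne_zero]
  simp only [fourierV_eq, enorm_mul, mul_pow]
  rw [lintegral_const_mul' _ _ (by simp), lintegral_comp_smul_R3 (fun w => ‖𝓕 g w‖ₑ ^ 2) hπ,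
    ← mul_assoc, abs_of_pos (by positivity), enorm_const_sq, one_mul]
  exact lintegral_fourier_sq_le hg

lemma lintegral_mul_le_eLpNorm_two {α F G : Type*} [MeasurableSpace α] {μ : Measure α}
    [NormedAddCommGroup F] [NormedAddCommGroup G] {f : α → F} {g : α → G}
    (hf : AEStronglyMeasurable f μ) (hg : AEStronglyMeasurable g μ) :
    ∫⁻ x, ‖f x‖ₑ * ‖g x‖ₑ ∂μ ≤ eLpNorm f 2 μ * eLpNorm g 2 μ := by
  have h := ENNReal.lintegral_mul_le_Lp_mul_Lq μ Real.HolderConjugate.two_two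
    hf.enorm hg.enorm
  simpa [eLpNorm_eq_lintegral_rpow_enorm_toReal two_ne_zero ENNReal.ofNat_ne_top] using h

/-! ### `L²` bounds for the line average `W` and for `Γ`. -/

section meanField

variable {E : R3 → R3}

lemma stronglyMeasurable_meanField (hE : StronglyMeasurable E) :
    StronglyMeasurable fun p : R3 × R3 => meanField E p.1 p.2 := by
  unfold meanField
  simp only [intervalIntegral.integral_of_le (show (-(1 / 2) : ℝ) ≤ 1 / 2 by norm_num)]
  apply StronglyMeasurable.integral_prod_right'
    (f := fun q : (R3 × R3) × ℝ => E (q.1.1 - q.2 • q.1.2))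
  exact hE.comp_measurable (by fun_prop)

/-- `‖W(·, η)‖₂ ≤ ‖E‖₂`. -/
lemma lintegral_meanField_sq_le (hE : StronglyMeasurable E) (η : R3) :
    ∫⁻ x, ‖meanField E x η‖ₑ ^ 2 ≤ ∫⁻ x, ‖E x‖ₑ ^ 2 := by
  have hm : Measurable fun p : R3 × ℝ => ‖E (p.1 - p.2 • η)‖ₑ :=
    (hE.comp_measurable (by fun_prop)).enorm
  -- `ν` is a probability measure, so Cauchy–Schwarz against `1` bounds the squared average by the
  -- average of the squares; translations by `r η` then drop out of the `x`-integral.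
  let ν : Measure ℝ := volume.restrict (Ioc (-(1 / 2)) (1 / 2))
  have hν : ν univ = 1 := by simp [ν]; norm_num
  calc ∫⁻ x, ‖meanField E x η‖ₑ ^ 2
      ≤ ∫⁻ x, ∫⁻ r, ‖E (x - r • η)‖ₑ ^ 2 ∂ν := by
        refine lintegral_mono fun x => ?_
        have h1 : ‖meanField E x η‖ₑ ≤ ∫⁻ r, ‖E (x - r • η)‖ₑ ∂ν := by
          rw [meanField, intervalIntegral.integral_of_le (by norm_num)]
          exact enorm_integral_le_lintegral_enorm _
        have hEx : StronglyMeasurable fun r : ℝ => E (x - r • η) :=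
          hE.comp_measurable (by fun_prop)
        have h2 := lintegral_mul_le_eLpNorm_two (μ := ν) (f := fun r : ℝ => E (x - r • η))
          (g := fun _ => (1 : ℝ)) hEx.aestronglyMeasurable
          aestronglyMeasurable_const
        have h3 : eLpNorm (fun _ : ℝ => (1 : ℝ)) 2 ν = 1 := by
          rw [eLpNorm_const _ two_ne_zero (by rw [← Measure.measure_univ_ne_zero, hν]; simp), hν]
          simp
        rw [h3] at h2
        simp only [enorm_one, mul_one] at h2
        rw [← eLpNorm_two_sq_eq]
        gcongr
        exact h1.trans h2
    _ = ∫⁻ r, (∫⁻ x, ‖E (x - r • η)‖ₑ ^ 2) ∂ν := by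
        exact lintegral_lintegral_swap (f := fun x r => ‖E (x - r • η)‖ₑ ^ 2)
          (hm.pow_const 2).aemeasurable
    _ = ∫⁻ _r, (∫⁻ x, ‖E x‖ₑ ^ 2) ∂ν := by
        refine lintegral_congr fun r => ?_
        exact lintegral_sub_right_eq_self (fun x => ‖E x‖ₑ ^ 2) (r • η)
    _ = _ := by rw [lintegral_const, hν, mul_one]

end meanField

section gamma

variable {E : R3 → R3} {φ : R3 → ℝ} {s : ℝ}

lemma stronglyMeasurable_fourierV (hφ : Continuous φ) (s : ℝ) :
    StronglyMeasurable fun p : R3 × R3 =>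
      fourierV (fun v => ((φ (p.1 + s • v) : ℝ) : ℂ)) p.2 := by
  unfold fourierV
  refine StronglyMeasurable.const_mul ?_ _
  apply StronglyMeasurable.integral_prod_right' (f := fun q : (R3 × R3) × R3 =>
    ((φ (q.1.1 + s • q.2) : ℝ) : ℂ) * Complex.exp (-(Complex.I * ((inner ℝ q.2 q.1.2 : ℝ) : ℂ))))
  exact Continuous.stronglyMeasurable (by fun_prop)

/-- The shift by `x` is a translation of `v` by `s⁻¹ x` and only contributes a phase. The modulus is
therefore independent of `x`, which decouples `x` from `η` in the estimate of `Γ`. -/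
lemma norm_fourierV_translate (φ : R3 → ℝ) (hs : s ≠ 0) (x η : R3) :
    ‖fourierV (fun v => ((φ (x + s • v) : ℝ) : ℂ)) η‖ₑ
      = ‖fourierV (fun v => ((φ (s • v) : ℝ) : ℂ)) η‖ₑ := by
  have h := congrFun (VectorFourier.fourierIntegral_comp_add_right Real.fourierChar volume
    (innerₗ R3) (fun v => ((φ (s • v) : ℝ) : ℂ)) (s⁻¹ • x)) ((2 * Real.pi)⁻¹ • η)
  have hfun : (fun v => ((φ (x + s • v) : ℝ) : ℂ))
      = (fun v => ((φ (s • v) : ℝ) : ℂ)) ∘ fun v => v + s⁻¹ • x := by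
    ext v
    simp [smul_smul, hs, add_comm]
  rw [fourierV_eq, fourierV_eq, hfun, enorm_mul, enorm_mul]
  congr 1
  refine Eq.trans (congrArg _ h) ?_
  rw [← ofReal_norm, Circle.norm_smul, ofReal_norm]
  rfl

lemma stronglyMeasurable_gammaOp (hE : StronglyMeasurable E) (hφ : Continuous φ) (k : Fin 3)
    (s : ℝ) : StronglyMeasurable fun p : Phase =>
      gammaOp E k (fun x v => ((φ (x + s • v) : ℝ) : ℂ)) p.1 p.2 := by
  unfold gammaOp invFourierV
  refine StronglyMeasurable.const_mul ?_ _
  apply StronglyMeasurable.integral_prod_right' (f := fun q : (R3 × R3) × R3 =>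
    ((meanField E q.1.1 q.2 k : ℝ) : ℂ) * fourierV (fun v => ((φ (q.1.1 + s • v) : ℝ) : ℂ)) q.2 *
      Complex.exp (Complex.I * ((inner ℝ q.1.2 q.2 : ℝ) : ℂ)))
  refine StronglyMeasurable.mul (StronglyMeasurable.mul ?_ ?_)
    (Continuous.stronglyMeasurable (by fun_prop))
  · have h := (stronglyMeasurable_meanField hE).comp_measurable
      (g := fun q : (R3 × R3) × R3 => (q.1.1, q.2)) (by fun_prop)
    exact (Complex.continuous_ofReal.comp
      (EuclideanSpace.proj (𝕜 := ℝ) k).continuous).comp_stronglyMeasurable h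
  · exact (stronglyMeasurable_fourierV hφ s).comp_measurable
      (g := fun q : (R3 × R3) × R3 => (q.1.1, q.2)) (by fun_prop)

/-- `‖Γ_k[E] ψ‖₂ ≤ s^{-3/2} ‖E‖₂ ‖φ‖₂` for `ψ(x, v) = φ(x + s v)`. -/
lemma lintegral_gammaOp_sq_le (hE : StronglyMeasurable E) (hφ : Continuous φ) (k : Fin 3)
    (hs : 0 < s) :
    ∫⁻ p : Phase, ‖gammaOp E k (fun x v => ((φ (x + s • v) : ℝ) : ℂ)) p.1 p.2‖ₑ ^ 2
      ≤ (∫⁻ x, ‖E x‖ₑ ^ 2) * (ENNReal.ofReal (s ^ 3)⁻¹ * ∫⁻ x, ‖φ x‖ₑ ^ 2) := by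
  let m : R3 → ℝ≥0∞ := fun η => ‖fourierV (fun v => ((φ (s • v) : ℝ) : ℂ)) η‖ₑ
  have hm : Measurable m := by
    have := (stronglyMeasurable_fourierV hφ s).comp_measurable
      (g := fun η : R3 => ((0 : R3), η)) (by fun_prop)
    simpa using this.enorm
  have hW := stronglyMeasurable_meanField hE
  have hmW : Measurable fun p : R3 × R3 => ‖meanField E p.1 p.2‖ₑ ^ 2 * m p.2 ^ 2 :=
    (hW.enorm.pow_const 2).mul ((hm.comp measurable_snd).pow_const 2)
  let G : R3 × R3 → ℝ≥0∞ := fun p =>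
    ‖gammaOp E k (fun x v => ((φ (x + s • v) : ℝ) : ℂ)) p.1 p.2‖ₑ ^ 2
  have hG : Measurable G := (stronglyMeasurable_gammaOp hE hφ k s).enorm.pow_const 2
  calc ∫⁻ p, G p = ∫⁻ x, ∫⁻ v, G (x, v) := lintegral_prod G hG.aemeasurable
    _ ≤ ∫⁻ x, ∫⁻ η, ‖meanField E x η‖ₑ ^ 2 * m η ^ 2 := by
        refine lintegral_mono fun x => ?_
        have hle := lintegral_invFourierV_sq_le (g := fun η => ((meanField E x η k : ℝ) : ℂ) *
          fourierV (fun v => ((φ (x + s • v) : ℝ) : ℂ)) η) ?_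
        · refine le_trans ?_ (hle.trans (lintegral_mono fun η => ?_))
          · exact le_of_eq rfl
          · rw [enorm_mul, mul_pow, norm_fourierV_translate φ hs.ne']
            gcongr
            rw [← ofReal_norm, ← ofReal_norm, Complex.norm_real]
            exact ENNReal.ofReal_le_ofReal (PiLp.norm_apply_le _ k)
        · refine StronglyMeasurable.aestronglyMeasurable (StronglyMeasurable.mul ?_ ?_)
          · exact (Complex.continuous_ofReal.comp
              (EuclideanSpace.proj (𝕜 := ℝ) k).continuous).comp_stronglyMeasurable
              (hW.comp_measurable (g := fun η : R3 => (x, η)) (by fun_prop))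
          · exact (stronglyMeasurable_fourierV hφ s).comp_measurable
              (g := fun η : R3 => (x, η)) (by fun_prop)
    -- The `x`-integral is taken first because `W(·, η)` is bounded in `L²` uniformly in `η`.
    _ = ∫⁻ η, ∫⁻ x, ‖meanField E x η‖ₑ ^ 2 * m η ^ 2 :=
        lintegral_lintegral_swap hmW.aemeasurable
    _ ≤ ∫⁻ η, (∫⁻ x, ‖E x‖ₑ ^ 2) * m η ^ 2 := by
        refine lintegral_mono fun η => ?_
        have hWη : Measurable fun x => ‖meanField E x η‖ₑ ^ 2 :=
          (hW.comp_measurable (g := fun x : R3 => (x, η)) (by fun_prop)).enorm.pow_const 2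
        rw [lintegral_mul_const _ hWη]
        exact mul_le_mul_left (lintegral_meanField_sq_le hE η) _
    _ = (∫⁻ x, ‖E x‖ₑ ^ 2) * ∫⁻ η, m η ^ 2 := lintegral_const_mul _ (hm.pow_const 2)
    _ ≤ _ := by
        gcongr
        refine (lintegral_fourierV_sq_le
          (Continuous.stronglyMeasurable (by fun_prop)).aestronglyMeasurable).trans (le_of_eq ?_)
        have := lintegral_comp_smul_R3 (fun x => ‖φ x‖ₑ ^ 2) hs.ne'
        rw [abs_of_pos hs] at this
        rw [← this]
        refine lintegral_congr fun x => ?_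
        rw [← ofReal_norm, ← ofReal_norm, Complex.norm_real]

/-- Cauchy–Schwarz on phase space. The power `s^{-3/2}` comes from the dilation `v ↦ s v` inside
`φ`; the weight `s` of the flux improves it to the integrable `s^{-1/2}`. -/
lemma enorm_gammaPair_le (hE : StronglyMeasurable E) (hφ : Continuous φ) (k : Fin 3)
    (hs : 0 < s) {u : Phase → ℝ} (hu : AEStronglyMeasurable u volume) :
    ‖gammaPair E k u (fun x v => ((φ (x + s • v) : ℝ) : ℂ))‖ₑ
      ≤ eLpNorm u 2 volume * (eLpNorm E 2 volume *
        (ENNReal.ofReal (s ^ (-(3 / 2) : ℝ)) * eLpNorm φ 2 volume)) := by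
  unfold gammaPair
  refine (enorm_integral_le_lintegral_enorm _).trans ?_
  have h := lintegral_mul_le_eLpNorm_two hu
    (stronglyMeasurable_gammaOp hE hφ k s).aestronglyMeasurable
  refine le_trans (le_of_eq (lintegral_congr fun p => ?_)) (h.trans ?_)
  · rw [enorm_mul, ← ofReal_norm, Complex.norm_real, ofReal_norm]
  · gcongr
    have h2 := lintegral_gammaOp_sq_le hE hφ k hs
    rw [← eLpNorm_two_sq_eq, ← eLpNorm_two_sq_eq, ← eLpNorm_two_sq_eq] at h2
    rw [← ENNReal.pow_le_pow_left_iff two_ne_zero]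
    refine h2.trans (le_of_eq ?_)
    rw [mul_pow, mul_pow, ← ENNReal.ofReal_pow (by positivity), ← Real.rpow_natCast (_ ^ _),
      ← Real.rpow_mul hs.le, ← Real.rpow_natCast s, ← Real.rpow_neg hs.le]
    norm_num

end gamma

/-! ### Gaussians and their Fourier transforms. -/

lemma integrable_norm_rpow_mul_gaussian {b m : ℝ} (hb : 0 < b) (hm : 0 ≤ m) :
    Integrable fun y : R3 => ‖y‖ ^ m * Real.exp (-b * ‖y‖ ^ 2) := by
  have h := integrable_fun_norm_addHaar (E := R3) volume
    (f := fun r : ℝ => r ^ m * Real.exp (-b * r ^ 2))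
  rw [finrank_R3] at h
  refine h.2 ((integrableOn_rpow_mul_exp_neg_mul_sq hb (s := m + 2) (by linarith)).congr_fun
    (fun r hr => ?_) measurableSet_Ioi)
  have hr' : 0 < r := hr
  simp only [smul_eq_mul]
  rw [Real.rpow_add hr']
  norm_num
  ring

/-- The Gaussian `e^{-π τ |y|²}`. -/
def gaussian (τ : ℝ) (y : R3) : ℝ := Real.exp (-(Real.pi * ‖y‖ ^ 2 * τ))

@[fun_prop]
lemma continuous_gaussian : Continuous fun p : ℝ × R3 => gaussian p.1 p.2 := by
  unfold gaussian; fun_prop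

variable {τ : ℝ}

lemma fourier_gaussian (hτ : 0 < τ) (ξ : R3) :
    𝓕 (fun y => ((gaussian τ y : ℝ) : ℂ)) ξ
      = ((τ ^ (-(3 / 2) : ℝ) * Real.exp (-(Real.pi / τ) * ‖ξ‖ ^ 2) : ℝ) : ℂ) := by
  have hb : 0 < ((Real.pi * τ : ℝ) : ℂ).re := by simpa using mul_pos Real.pi_pos hτ
  have h := fourier_gaussian_innerProductSpace (V := R3) hb ξ
  rw [finrank_R3] at h
  convert h using 2
  · ext y
    simp only [gaussian]
    push_cast
    ring_nf
  · have h1 : (Real.pi : ℂ) / ((Real.pi * τ : ℝ) : ℂ) = ((τ⁻¹ : ℝ) : ℂ) := by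
      push_cast
      have : (Real.pi : ℂ) ≠ 0 := by exact_mod_cast Real.pi_ne_zero
      field_simp
    rw [h1, Complex.ofReal_mul, Real.rpow_neg hτ.le, ← Real.inv_rpow hτ.le,
      Complex.ofReal_cpow (by positivity)]
    congr 1
    · norm_num
    · push_cast
      congr 1
      have : (Real.pi : ℂ) ≠ 0 := by exact_mod_cast Real.pi_ne_zero
      have : (τ : ℂ) ≠ 0 := by exact_mod_cast hτ.ne'
      field_simp

lemma gaussian_eq (τ : ℝ) (y : R3) : gaussian τ y = Real.exp (-(Real.pi * τ) * ‖y‖ ^ 2) := by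
  unfold gaussian; congr 1; ring

lemma norm_ofReal_gaussian (τ : ℝ) (y : R3) : ‖((gaussian τ y : ℝ) : ℂ)‖ = gaussian τ y := by
  rw [Complex.norm_real, gaussian, Real.norm_of_nonneg (Real.exp_pos _).le]

lemma integrable_ofReal_gaussian (hτ : 0 < τ) :
    Integrable fun y : R3 => ((gaussian τ y : ℝ) : ℂ) := by
  have := integrable_norm_rpow_mul_gaussian (mul_pos Real.pi_pos hτ) le_rfl
  simp only [Real.rpow_zero, one_mul, ← gaussian_eq] at this
  exact this.ofReal

lemma integrable_norm_mul_gaussian (hτ : 0 < τ) :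
    Integrable fun y : R3 => ‖y‖ * gaussian τ y := by
  have := integrable_norm_rpow_mul_gaussian (mul_pos Real.pi_pos hτ) zero_le_one
  simpa only [Real.rpow_one, ← gaussian_eq] using this

lemma hasFDerivAt_mul_exp_norm_sq (a b : ℝ) (ξ : R3) :
    HasFDerivAt (fun ξ : R3 => a * Real.exp (-b * ‖ξ‖ ^ 2))
      ((-(2 * b) * (a * Real.exp (-b * ‖ξ‖ ^ 2))) • innerSL ℝ ξ) ξ := by
  have h := (((hasStrictFDerivAt_norm_sq ξ).hasFDerivAt.const_mul (-b)).exp).const_mul a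
  refine h.congr_fderiv ?_
  ext v
  simp
  ring

/-- The Fourier transform of `y_j e^{-π τ |y|²}` is `-i ξ_j τ^{-5/2} e^{-π |ξ|² / τ}`. -/
lemma fourier_coord_gaussian (hτ : 0 < τ) (j : Fin 3) (ξ : R3) :
    (-(2 * Real.pi * Complex.I)) * 𝓕 (fun y : R3 => ((y j * gaussian τ y : ℝ) : ℂ)) ξ
      = ((-(2 * (Real.pi / τ)) * (τ ^ (-(3 / 2) : ℝ) * Real.exp (-(Real.pi / τ) * ‖ξ‖ ^ 2))
        * ξ j : ℝ) : ℂ) := by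
  let G : R3 → ℂ := fun y => ((gaussian τ y : ℝ) : ℂ)
  have hG : Integrable G := integrable_ofReal_gaussian hτ
  have hG1 : Integrable fun y => ‖y‖ * ‖G y‖ := by
    simpa only [G, norm_ofReal_gaussian] using integrable_norm_mul_gaussian hτ
  -- The derivative of the transformed Gaussian is computed twice, under the integral (producing the
  -- factor `-2πi y_j`) and from the closed form; uniqueness of the derivative identifies the two.
  have hd := Real.hasFDerivAt_fourier hG hG1 ξ
  have hd2 : HasFDerivAt (𝓕 G) (Complex.ofRealCLM.comp
      ((-(2 * (Real.pi / τ)) * (τ ^ (-(3 / 2) : ℝ) * Real.exp (-(Real.pi / τ) * ‖ξ‖ ^ 2))) •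
        innerSL ℝ ξ)) ξ := by
    have : 𝓕 G = fun ξ : R3 => Complex.ofRealCLM
        (τ ^ (-(3 / 2) : ℝ) * Real.exp (-(Real.pi / τ) * ‖ξ‖ ^ 2)) :=
      funext fun ξ => fourier_gaussian hτ ξ
    rw [this]
    exact Complex.ofRealCLM.hasFDerivAt.comp ξ (hasFDerivAt_mul_exp_norm_sq _ _ ξ)
  have heq := DFunLike.congr_fun (hd.unique hd2) (EuclideanSpace.single j (1 : ℝ))
  have hint : Integrable (VectorFourier.fourierSMulRight (innerSL ℝ) G) := by
    refine (hG1.const_mul (2 * Real.pi)).mono' hG.1.fourierSMulRight (ae_of_all _ fun v => ?_)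
    rw [VectorFourier.norm_fourierSMulRight, innerSL_apply_norm, mul_assoc]
  rw [Real.fourier_continuousLinearMap_apply hint] at heq
  have hfun : (fun y => VectorFourier.fourierSMulRight (innerSL ℝ) G y
      (EuclideanSpace.single j (1 : ℝ)))
      = (-(2 * Real.pi * Complex.I)) • fun y : R3 => ((y j * gaussian τ y : ℝ) : ℂ) := by
    ext y
    rw [VectorFourier.fourierSMulRight_apply, innerSL_apply_apply,
      EuclideanSpace.inner_single_right]
    simp [G]
  have hsm : 𝓕 ((-(2 * Real.pi * Complex.I)) • fun y : R3 => ((y j * gaussian τ y : ℝ) : ℂ)) ξ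
      = (-(2 * Real.pi * Complex.I)) • 𝓕 (fun y : R3 => ((y j * gaussian τ y : ℝ) : ℂ)) ξ :=
    congrFun (VectorFourier.fourierIntegral_const_smul Real.fourierChar volume (innerₗ R3) _ _) ξ
  rw [hfun, hsm, smul_eq_mul] at heq
  rw [heq, ContinuousLinearMap.comp_apply, Complex.ofRealCLM_apply]
  simp [EuclideanSpace.inner_single_right]

lemma norm_fourier_coord_gaussian_le (hτ : 0 < τ) (j : Fin 3) (ξ : R3) :
    ‖𝓕 (fun y : R3 => ((y j * gaussian τ y : ℝ) : ℂ)) ξ‖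
      ≤ ‖ξ‖ * (τ ^ (-(5 / 2) : ℝ) * Real.exp (-(Real.pi / τ) * ‖ξ‖ ^ 2)) := by
  have hn := congrArg norm (fourier_coord_gaussian hτ j ξ)
  have hπ : ‖(-(2 * Real.pi * Complex.I))‖ = 2 * Real.pi := by
    simp [abs_of_pos Real.pi_pos]
  have hξ : |ξ j| ≤ ‖ξ‖ := by simpa using PiLp.norm_apply_le ξ j
  have h52 : τ ^ (-(5 / 2) : ℝ) = τ⁻¹ * τ ^ (-(3 / 2) : ℝ) := by
    rw [← Real.rpow_neg_one, ← Real.rpow_add hτ]; norm_num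
  rw [norm_mul, hπ, Complex.norm_real, norm_mul, norm_mul, Real.norm_eq_abs, abs_neg,
    abs_of_pos (show 0 < 2 * (Real.pi / τ) by positivity),
    Real.norm_of_nonneg (by positivity), Real.norm_eq_abs] at hn
  have : ‖𝓕 (fun y : R3 => ((y j * gaussian τ y : ℝ) : ℂ)) ξ‖
      = |ξ j| * (τ ^ (-(5 / 2) : ℝ) * Real.exp (-(Real.pi / τ) * ‖ξ‖ ^ 2)) := by
    refine mul_left_cancel₀ (show 2 * Real.pi ≠ 0 by positivity) (hn.trans ?_)
    rw [h52]
    ring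
  rw [this]
  gcongr

/-- `∫_a^b τ^{-2} e^{-c/τ} dτ ≤ 1/c`. -/
lemma setIntegral_inv_sq_exp_le {a b c : ℝ} (ha : 0 < a) (hab : a ≤ b) (hc : 0 < c) :
    IntegrableOn (fun τ : ℝ => τ ^ (-2 : ℝ) * Real.exp (-(c / τ))) (Ioc a b) ∧
    ∫ τ in Ioc a b, τ ^ (-2 : ℝ) * Real.exp (-(c / τ)) ≤ c⁻¹ := by
  have hder : ∀ τ ∈ uIcc a b, HasDerivAt (fun τ : ℝ => c⁻¹ * Real.exp (-(c / τ)))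
      (τ ^ (-2 : ℝ) * Real.exp (-(c / τ))) τ := by
    intro τ hτ
    rw [uIcc_of_le hab] at hτ
    have hτ0 : 0 < τ := ha.trans_le hτ.1
    have h := ((((hasDerivAt_inv hτ0.ne').const_mul c).neg).exp).const_mul c⁻¹
    refine (h.congr_deriv ?_)
    rw [Real.rpow_neg hτ0.le, Real.rpow_two]
    simp only [Pi.neg_apply, ← div_eq_mul_inv]
    field_simp
  have hcont : ContinuousOn (fun τ : ℝ => τ ^ (-2 : ℝ) * Real.exp (-(c / τ))) (uIcc a b) := by
    rw [uIcc_of_le hab]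
    intro τ hτ
    have hτ0 : τ ≠ 0 := (ha.trans_le hτ.1).ne'
    refine ContinuousAt.continuousWithinAt ?_
    refine (Real.continuousAt_rpow_const _ _ (Or.inl hτ0)).mul ?_
    exact Real.continuous_exp.continuousAt.comp (continuousAt_const.div continuousAt_id hτ0).neg
  have hii := hcont.intervalIntegrable (μ := volume)
  refine ⟨(intervalIntegrable_iff_integrableOn_Ioc_of_le hab).1 hii, ?_⟩
  rw [← intervalIntegral.integral_of_le hab,
    intervalIntegral.integral_eq_sub_of_hasDerivAt hder hii]
  have h1 : Real.exp (-(c / b)) ≤ 1 := Real.exp_le_one_iff.2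
    (neg_nonpos.2 (div_nonneg hc.le (ha.le.trans hab)))
  have h2 := Real.exp_pos (-(c / a))
  have hc' : 0 < c⁻¹ := inv_pos.2 hc
  nlinarith

/-! ### The Coulomb kernel as a superposition of Gaussians. -/

/-- The range `(1/(n+1), n+1]` of Gaussian widths kept in the regularized Coulomb kernel. -/
def widths (n : ℕ) : Set ℝ := Ioc ((n + 1 : ℝ)⁻¹) (n + 1)

lemma measurableSet_widths (n : ℕ) : MeasurableSet (widths n) := measurableSet_Ioc

lemma pos_of_mem_widths {n : ℕ} {τ : ℝ} (h : τ ∈ widths n) : 0 < τ :=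
  lt_trans (by positivity) h.1

lemma monotone_widths : Monotone widths := by
  intro m n hmn
  have : (m : ℝ) ≤ n := by exact_mod_cast hmn
  apply Ioc_subset_Ioc
  · gcongr
  · gcongr

lemma iUnion_widths : ⋃ n, widths n = Ioi 0 := by
  ext τ
  simp only [mem_iUnion, mem_Ioi]
  refine ⟨fun ⟨n, h⟩ => pos_of_mem_widths h, fun h => ?_⟩
  obtain ⟨n, hn⟩ := exists_nat_gt (max τ τ⁻¹)
  refine ⟨n, ?_, ?_⟩
  · rw [inv_lt_comm₀ (by positivity) h]
    linarith [le_max_right τ τ⁻¹]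
  · linarith [le_max_left τ τ⁻¹]

instance (n : ℕ) : IsFiniteMeasure ((volume : Measure ℝ).restrict (widths n)) :=
  ⟨by rw [Measure.restrict_apply_univ]; exact measure_Ioc_lt_top⟩

/-- The Coulomb kernel `1/(4π|y|³)` as a superposition of Gaussians, with the very narrow and the
very wide ones left out. -/
def regKernel (n : ℕ) (y : R3) : ℝ := 1 / 2 * ∫ τ in widths n, τ ^ (1 / 2 : ℝ) * gaussian τ y

lemma integrableOn_superposition {y : R3} (hy : y ≠ 0) :
    IntegrableOn (fun τ : ℝ => τ ^ (1 / 2 : ℝ) * gaussian τ y) (Ioi 0) := by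
  have hy' : 0 < Real.pi * ‖y‖ ^ 2 := by positivity
  have := integrableOn_rpow_mul_exp_neg_mul_rpow (p := 1) (s := 1 / 2) (by norm_num) zero_lt_one hy'
  refine this.congr_fun (fun τ _ => ?_) measurableSet_Ioi
  simp [gaussian]

/-- A Gamma integral: `∫ τ^{1/2} e^{-π|y|²τ} dτ = Γ(3/2) (π|y|²)^{-3/2} = 1/(2π|y|³)`, as `Γ(3/2) =
√π/2`. -/
lemma integral_superposition {y : R3} (hy : y ≠ 0) :
    1 / 2 * ∫ τ in Ioi (0 : ℝ), τ ^ (1 / 2 : ℝ) * gaussian τ y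
      = 1 / (4 * Real.pi) * (‖y‖ ^ 3)⁻¹ := by
  have hy0 : 0 < ‖y‖ := norm_pos_iff.2 hy
  have hy' : 0 < Real.pi * ‖y‖ ^ 2 := by positivity
  have h := Real.integral_rpow_mul_exp_neg_mul_Ioi (a := 3 / 2) (by norm_num) hy'
  norm_num at h
  have hΓ : Real.Gamma (3 / 2) = √Real.pi / 2 := by
    rw [show (3 / 2 : ℝ) = 1 / 2 + 1 by norm_num, Real.Gamma_add_one (by norm_num),
      Real.Gamma_one_half_eq]
    ring
  rw [hΓ] at h
  simp only [gaussian, one_div] at h ⊢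
  rw [h, Real.mul_rpow (by positivity) (by positivity), Real.inv_rpow (by positivity),
    Real.inv_rpow (by positivity), ← Real.rpow_natCast, ← Real.rpow_mul hy0.le,
    show (3 / 2 : ℝ) = 1 + 1 / 2 by norm_num, Real.rpow_add Real.pi_pos, ← Real.sqrt_eq_rpow]
  norm_num
  have : √Real.pi ≠ 0 := by positivity
  field_simp
  norm_num

lemma regKernel_nonneg (n : ℕ) (y : R3) : 0 ≤ regKernel n y := by
  refine mul_nonneg (by norm_num) (setIntegral_nonneg (measurableSet_widths n) fun τ hτ => ?_)
  exact mul_nonneg (Real.rpow_nonneg (pos_of_mem_widths hτ).le _) (Real.exp_pos _).le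

lemma regKernel_le {y : R3} (hy : y ≠ 0) (n : ℕ) :
    regKernel n y ≤ 1 / (4 * Real.pi) * (‖y‖ ^ 3)⁻¹ := by
  rw [← integral_superposition hy]
  unfold regKernel
  gcongr 1 / 2 * ?_
  refine setIntegral_mono_set (integrableOn_superposition hy) ?_
    (ae_of_all _ fun τ hτ => pos_of_mem_widths hτ)
  filter_upwards [ae_restrict_mem measurableSet_Ioi] with τ hτ
  exact mul_nonneg (Real.rpow_nonneg (le_of_lt hτ) _) (Real.exp_pos _).le

lemma tendsto_regKernel {y : R3} (hy : y ≠ 0) :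
    Tendsto (fun n => regKernel n y) atTop (𝓝 (1 / (4 * Real.pi) * (‖y‖ ^ 3)⁻¹)) := by
  rw [← integral_superposition hy]
  refine Tendsto.const_mul _ ?_
  have := tendsto_setIntegral_of_monotone measurableSet_widths monotone_widths
    (f := fun τ : ℝ => τ ^ (1 / 2 : ℝ) * gaussian τ y)
    (by rw [iUnion_widths]; exact integrableOn_superposition hy)
  rwa [iUnion_widths] at this

/-- The `j`-th component of the regularized Coulomb field of a unit charge. -/
def regCoulomb (n : ℕ) (j : Fin 3) (y : R3) : ℂ := ((regKernel n y * y j : ℝ) : ℂ)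

/-- Uniformity in `n` provides the dominating function when the regularization is removed. -/
lemma norm_regCoulomb_le (n : ℕ) (j : Fin 3) (y : R3) : ‖regCoulomb n j y‖ ≤ ‖coulomb y‖ := by
  rcases eq_or_ne y 0 with rfl | hy
  · simp [regCoulomb]
  rw [regCoulomb, Complex.norm_real, norm_mul, coulomb, norm_smul,
    Real.norm_of_nonneg (regKernel_nonneg n y),
    Real.norm_of_nonneg (show 0 ≤ 1 / (4 * Real.pi) * (‖y‖ ^ 3)⁻¹ by positivity)]
  exact mul_le_mul (regKernel_le hy n) (PiLp.norm_apply_le y j) (norm_nonneg _) (by positivity)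

lemma tendsto_regCoulomb (j : Fin 3) (y : R3) :
    Tendsto (fun n => regCoulomb n j y) atTop (𝓝 ((coulomb y j : ℝ) : ℂ)) := by
  rcases eq_or_ne y 0 with rfl | hy
  · simp [regCoulomb, coulomb]
  · have : coulomb y j = 1 / (4 * Real.pi) * (‖y‖ ^ 3)⁻¹ * y j := by simp [coulomb]
    rw [this]
    exact (Complex.continuous_ofReal.tendsto _).comp ((tendsto_regKernel hy).mul_const _)

/-- The integrand in `regCoulomb`. -/
def regIntegrand (j : Fin 3) (p : ℝ × R3) : ℂ :=
  ((p.1 ^ (1 / 2 : ℝ) * (p.2 j * gaussian p.1 p.2) : ℝ) : ℂ)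

lemma continuous_regIntegrand (j : Fin 3) : Continuous (regIntegrand j) := by
  unfold regIntegrand
  have : Continuous fun p : ℝ × R3 => p.1 ^ (1 / 2 : ℝ) :=
    continuous_fst.rpow_const fun _ => Or.inr (by norm_num)
  fun_prop

/-- On `widths n` every Gaussian lies below the one with `τ = 1/(n+1)`, and `τ^{1/2}` is bounded.
This joint integrability permits Fubini and makes the regularized kernel integrable, unlike the
Coulomb kernel. -/
lemma integrable_regIntegrand (n : ℕ) (j : Fin 3) :
    Integrable (regIntegrand j) ((volume.restrict (widths n)).prod volume) := by
  set a : ℝ := (n + 1 : ℝ)⁻¹ with ha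
  have ha0 : 0 < a := by positivity
  have hb : Integrable (fun p : ℝ × R3 => (n + 1 : ℝ) ^ (1 / 2 : ℝ) * (‖p.2‖ * gaussian a p.2))
      ((volume.restrict (widths n)).prod volume) :=
    ((integrable_norm_mul_gaussian ha0).const_mul _).comp_snd _
  refine hb.mono' (continuous_regIntegrand j).aestronglyMeasurable ?_
  have hmem : ∀ᵐ p : ℝ × R3 ∂((volume.restrict (widths n)).prod volume), p.1 ∈ widths n :=
    Measure.quasiMeasurePreserving_fst.ae (ae_restrict_mem (measurableSet_widths n))
  filter_upwards [hmem] with p hp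
  have hp0 := pos_of_mem_widths hp
  rw [regIntegrand, Complex.norm_real, norm_mul, norm_mul, gaussian, gaussian,
    Real.norm_of_nonneg (by positivity), Real.norm_of_nonneg (Real.exp_pos _).le]
  gcongr
  · exact hp.2
  · exact PiLp.norm_apply_le p.2 j
  · exact hp.1.le

lemma regCoulomb_eq (n : ℕ) (j : Fin 3) (y : R3) :
    regCoulomb n j y = (1 / 2 : ℂ) * ∫ τ in widths n, regIntegrand j (τ, y) := by
  have : ∀ τ, regIntegrand j (τ, y)
      = (((τ ^ (1 / 2 : ℝ) * gaussian τ y) * y j : ℝ) : ℂ) := fun τ => by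
    unfold regIntegrand; congr 1; ring
  simp only [this]
  rw [integral_complex_ofReal, integral_mul_const, regCoulomb, regKernel]
  push_cast
  ring

lemma integrable_regCoulomb (n : ℕ) (j : Fin 3) : Integrable (regCoulomb n j) := by
  have := (integrable_regIntegrand n j).integral_prod_right.const_mul (1 / 2 : ℂ)
  refine this.congr (ae_of_all _ fun y => ?_)
  simp only [regCoulomb_eq]

/-- The Fourier multiplier of the regularized kernel is bounded by `1/(2π|ξ|)`. -/
lemma norm_fourier_regCoulomb_le (n : ℕ) (j : Fin 3) (ξ : R3) :
    2 * Real.pi * ‖ξ‖ * ‖𝓕 (regCoulomb n j) ξ‖ ≤ 1 := by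
  rcases eq_or_ne ξ 0 with rfl | hξ
  · simp
  have hξ0 : 0 < ‖ξ‖ := norm_pos_iff.2 hξ
  let e : R3 → Circle := fun y => Real.fourierChar (-inner ℝ y ξ)
  have he : Continuous e := by fun_prop
  have hswap : 𝓕 (regCoulomb n j) ξ = (1 / 2 : ℂ) * ∫ τ in widths n,
      ((τ ^ (1 / 2 : ℝ) : ℝ) : ℂ) * 𝓕 (fun y : R3 => ((y j * gaussian τ y : ℝ) : ℂ)) ξ := by
    have hint : Integrable (fun q : R3 × ℝ => (e q.1 : ℂ) * regIntegrand j (q.2, q.1))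
        ((volume : Measure R3).prod (volume.restrict (widths n))) := by
      refine (integrable_regIntegrand n j).swap.bdd_mul (f := fun q : R3 × ℝ => (e q.1 : ℂ))
        (c := 1) ?_ (ae_of_all _ fun q => ?_)
      · exact Continuous.aestronglyMeasurable (by fun_prop)
      · exact (Circle.norm_coe _).le
    have hs := integral_integral_swap
      (f := fun (y : R3) (τ : ℝ) => (e y : ℂ) * regIntegrand j (τ, y)) hint
    rw [Real.fourier_eq]
    calc ∫ y, e y • regCoulomb n j y
        = ∫ y, (1 / 2 : ℂ) * ∫ τ in widths n, (e y : ℂ) * regIntegrand j (τ, y) := by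
          refine integral_congr_ae (ae_of_all _ fun y => ?_)
          simp only
          rw [regCoulomb_eq, Circle.smul_def, smul_eq_mul, integral_const_mul]
          ring
      _ = _ := by
          rw [integral_const_mul, hs]
          congr 1
          refine integral_congr_ae (ae_of_all _ fun τ => ?_)
          simp only
          rw [Real.fourier_eq, ← integral_const_mul]
          refine integral_congr_ae (ae_of_all _ fun y => ?_)
          simp only [regIntegrand, Circle.smul_def, smul_eq_mul, e]
          push_cast
          ring
  have hc : 0 < Real.pi * ‖ξ‖ ^ 2 := by positivity
  have hn1 : (0 : ℝ) ≤ n := n.cast_nonneg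
  obtain ⟨hI, hle⟩ := setIntegral_inv_sq_exp_le (a := (n + 1 : ℝ)⁻¹) (b := n + 1) (by positivity)
    ((inv_le_one_of_one_le₀ (by linarith)).trans (by linarith)) hc
  -- The weight combines as `τ^{1/2} τ^{-5/2} = τ^{-2}`, so the integral of `τ^{-2} e^{-π|ξ|²/τ}` is
  -- at most `1/(π|ξ|²)` for every `n`. Multiplied by `|ξ|/2` this is `1/(2π|ξ|)`.
  have hbound : ‖∫ τ in widths n, ((τ ^ (1 / 2 : ℝ) : ℝ) : ℂ) *
      𝓕 (fun y : R3 => ((y j * gaussian τ y : ℝ) : ℂ)) ξ‖ ≤ ‖ξ‖ * (Real.pi * ‖ξ‖ ^ 2)⁻¹ := by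
    refine (norm_integral_le_of_norm_le (hI.const_mul ‖ξ‖) ?_).trans ?_
    · filter_upwards [ae_restrict_mem (measurableSet_widths n)] with τ hτ
      have hτ0 := pos_of_mem_widths hτ
      rw [norm_mul, Complex.norm_real, Real.norm_of_nonneg (by positivity)]
      refine (mul_le_mul_of_nonneg_left (norm_fourier_coord_gaussian_le hτ0 j ξ)
        (by positivity)).trans (le_of_eq ?_)
      rw [mul_left_comm, ← mul_assoc (τ ^ _), ← Real.rpow_add hτ0]
      rw [show (1 / 2 : ℝ) + -(5 / 2) = -2 by norm_num,
        show -(Real.pi / τ) * ‖ξ‖ ^ 2 = -(Real.pi * ‖ξ‖ ^ 2 / τ) by ring]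
    · rw [integral_const_mul]
      exact mul_le_mul_of_nonneg_left hle (norm_nonneg _)
  rw [hswap, norm_mul]
  have h2 : ‖(1 / 2 : ℂ)‖ = 1 / 2 := by simp
  rw [h2]
  calc _ ≤ 2 * Real.pi * ‖ξ‖ * (1 / 2 * (‖ξ‖ * (Real.pi * ‖ξ‖ ^ 2)⁻¹)) := by gcongr
    _ = 1 := by field_simp

/-! ### Second-order Riesz transforms on `L²`. -/

/-- A real Schwartz function, viewed as a complex one. -/
def complexify (φ : 𝓢(R3, ℝ)) : 𝓢(R3, ℂ) := φ.postcompCLM Complex.ofRealCLM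

lemma complexify_apply (φ : 𝓢(R3, ℝ)) (x : R3) : complexify φ x = ((φ x : ℝ) : ℂ) := rfl

/-- The partial derivative `∂_k φ`. -/
def partialDeriv (φ : 𝓢(R3, ℝ)) (k : Fin 3) : 𝓢(R3, ℝ) := ∂_{EuclideanSpace.single k (1 : ℝ)} φ

lemma partialDeriv_apply (φ : 𝓢(R3, ℝ)) (k : Fin 3) (x : R3) :
    partialDeriv φ k x = fderiv ℝ φ x (EuclideanSpace.single k 1) :=
  SchwartzMap.lineDerivOp_apply_eq_fderiv _ _ _

lemma complexify_partialDeriv (φ : 𝓢(R3, ℝ)) (k : Fin 3) :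
    complexify (partialDeriv φ k) = ∂_{EuclideanSpace.single k (1 : ℝ)} (complexify φ) := by
  ext x
  rw [complexify_apply, partialDeriv_apply, SchwartzMap.lineDerivOp_apply_eq_fderiv]
  have h := (Complex.ofRealCLM.hasFDerivAt (x := φ x)).comp x φ.differentiableAt.hasFDerivAt
  have h2 : fderiv ℝ (complexify φ) x = Complex.ofRealCLM.comp (fderiv ℝ φ x) := h.fderiv
  rw [h2]
  rfl

/-- The factor `2π|ξ|` is exactly what the decay in `norm_fourier_regCoulomb_le` compensates. -/
lemma norm_fourier_partialDeriv_le (φ : 𝓢(R3, ℝ)) (k : Fin 3) (ξ : R3) :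
    ‖𝓕 (complexify (partialDeriv φ k) : R3 → ℂ) ξ‖
      ≤ 2 * Real.pi * ‖ξ‖ * ‖𝓕 (complexify φ : R3 → ℂ) ξ‖ := by
  have hg : (inner ℝ · (EuclideanSpace.single k (1 : ℝ)) : R3 → ℝ).HasTemperateGrowth :=
    ((innerSL ℝ).flip _).hasTemperateGrowth
  rw [complexify_partialDeriv, ← SchwartzMap.fourier_coe, SchwartzMap.fourier_lineDerivOp_eq,
    ← SchwartzMap.fourier_coe]
  simp only [_root_.smul_apply, SchwartzMap.smulLeftCLM_apply_apply hg, norm_smul]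
  have h1 : ‖(2 * Real.pi * Complex.I : ℂ)‖ = 2 * Real.pi := by simp [abs_of_pos Real.pi_pos]
  have h2 : ‖inner ℝ ξ (EuclideanSpace.single k (1 : ℝ))‖ ≤ ‖ξ‖ := by
    rw [EuclideanSpace.inner_single_right]
    simpa using PiLp.norm_apply_le ξ k
  rw [h1, mul_assoc (2 * Real.pi)]
  gcongr

/-- The regularized field of a density is a Fourier multiplier. -/
lemma integral_mul_regCoulomb (g : 𝓢(R3, ℂ)) (n : ℕ) (j : Fin 3) (x : R3) :
    ∫ y, g y * regCoulomb n j (x - y)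
      = 𝓕 (fun ξ => 𝓕 (g : R3 → ℂ) ξ * 𝓕 (regCoulomb n j) ξ) (-x) := by
  -- The modulation is chosen so that `𝓕 h y = g (x - y)`; the convolution then becomes a pairing in
  -- which the transform can be moved onto the kernel.
  let h : R3 → ℂ := fun ξ => (Real.fourierChar (inner ℝ ξ x) : ℂ) * 𝓕 (g : R3 → ℂ) ξ
  have hĝ : Integrable (𝓕 (g : R3 → ℂ)) := by
    rw [← SchwartzMap.fourier_coe]; exact (𝓕 g).integrable
  have hh : Integrable h := by
    refine hĝ.bdd_mul (f := fun ξ : R3 => (Real.fourierChar (inner ℝ ξ x) : ℂ)) (c := 1)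
      (Continuous.aestronglyMeasurable (by fun_prop)) (ae_of_all _ fun ξ => ?_)
    exact (Circle.norm_coe _).le
  have hFh : ∀ y, 𝓕 h y = g (x - y) := by
    intro y
    have hinv : 𝓕⁻ (𝓕 (g : R3 → ℂ)) (x - y) = g (x - y) := by
      rw [← SchwartzMap.fourier_coe, ← SchwartzMap.fourierInv_coe, FourierTransform.fourierInv_fourier_eq]
    rw [← hinv, Real.fourier_eq, Real.fourierInv_eq]
    refine integral_congr_ae (ae_of_all _ fun ξ => ?_)
    simp only [h, Circle.smul_def, smul_eq_mul]
    rw [← mul_assoc, ← Circle.coe_mul, ← AddChar.map_add_eq_mul, inner_sub_right]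
    congr 3
    ring
  have hflip := VectorFourier.integral_fourierIntegral_smul_eq_flip (μ := volume) (ν := volume)
    (L := innerₗ R3) Real.continuous_fourierChar continuous_inner hh (integrable_regCoulomb n j)
  rw [flip_innerₗ] at hflip
  calc ∫ y, g y * regCoulomb n j (x - y) = ∫ y, g (x - y) * regCoulomb n j y := by
        rw [← integral_sub_left_eq_self _ volume x]
        simp
    _ = ∫ y, 𝓕 h y • regCoulomb n j y := by simp only [hFh, smul_eq_mul]
    _ = ∫ ξ, h ξ • 𝓕 (regCoulomb n j) ξ := hflip
    _ = _ := by
        rw [Real.fourier_eq]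
        refine integral_congr_ae (ae_of_all _ fun ξ => ?_)
        simp only [h, Circle.smul_def, smul_eq_mul, inner_neg_right, neg_neg]
        ring

lemma continuous_fourier {f : R3 → ℂ} (hf : Integrable f) : Continuous (𝓕 f) :=
  VectorFourier.fourierIntegral_continuous Real.continuous_fourierChar (innerSL ℝ).continuous₂ hf

lemma eLpNorm_two_le_of_sq_le {α F G : Type*} [MeasurableSpace α] {μ : Measure α}
    [NormedAddCommGroup F] [NormedAddCommGroup G] {f : α → F} {g : α → G}
    (h : ∫⁻ x, ‖f x‖ₑ ^ 2 ∂μ ≤ ∫⁻ x, ‖g x‖ₑ ^ 2 ∂μ) : eLpNorm f 2 μ ≤ eLpNorm g 2 μ := by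
  rwa [← ENNReal.pow_le_pow_left_iff two_ne_zero, eLpNorm_two_sq_eq, eLpNorm_two_sq_eq]

lemma eLpNorm_complexify (φ : 𝓢(R3, ℝ)) : eLpNorm (complexify φ) 2 volume = eLpNorm φ 2 volume :=
  eLpNorm_congr_norm_ae (ae_of_all _ fun x => by rw [complexify_apply, Complex.norm_real])

/-- The regularized second-order Riesz transforms are contractions of `L²`. -/
lemma eLpNorm_regCoulomb_conv_partialDeriv_le (φ : 𝓢(R3, ℝ)) (n : ℕ) (j k : Fin 3) :
    Continuous (fun x => ∫ y, complexify (partialDeriv φ k) y * regCoulomb n j (x - y)) ∧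
    eLpNorm (fun x => ∫ y, complexify (partialDeriv φ k) y * regCoulomb n j (x - y)) 2 volume
      ≤ eLpNorm φ 2 volume := by
  set g := complexify (partialDeriv φ k)
  let q : R3 → ℂ := fun ξ => 𝓕 (g : R3 → ℂ) ξ * 𝓕 (regCoulomb n j) ξ
  have hĝ : Integrable (𝓕 (g : R3 → ℂ)) := by
    rw [← SchwartzMap.fourier_coe]; exact (𝓕 g).integrable
  have hκ := continuous_fourier (integrable_regCoulomb n j)
  have hq : Integrable q := by
    refine hĝ.mul_bdd (c := ∫ y, ‖regCoulomb n j y‖) hκ.aestronglyMeasurable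
      (ae_of_all _ fun ξ => ?_)
    exact VectorFourier.norm_fourierIntegral_le_integral_norm _ _ _ _ _
  have hqle : ∀ ξ, ‖q ξ‖ ≤ ‖𝓕 (complexify φ : R3 → ℂ) ξ‖ := by
    intro ξ
    rw [norm_mul]
    calc _ ≤ (2 * Real.pi * ‖ξ‖ * ‖𝓕 (complexify φ : R3 → ℂ) ξ‖) * ‖𝓕 (regCoulomb n j) ξ‖ := by
          gcongr; exact norm_fourier_partialDeriv_le φ k ξ
      _ = (2 * Real.pi * ‖ξ‖ * ‖𝓕 (regCoulomb n j) ξ‖) * ‖𝓕 (complexify φ : R3 → ℂ) ξ‖ := by ring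
      _ ≤ 1 * ‖𝓕 (complexify φ : R3 → ℂ) ξ‖ := by
          gcongr; exact norm_fourier_regCoulomb_le n j ξ
      _ = _ := one_mul _
  simp only [integral_mul_regCoulomb]
  refine ⟨(continuous_fourier hq).comp continuous_neg, ?_⟩
  rw [← eLpNorm_complexify]
  refine eLpNorm_two_le_of_sq_le ?_
  calc ∫⁻ x, ‖𝓕 q (-x)‖ₑ ^ 2 = ∫⁻ x, ‖𝓕 q x‖ₑ ^ 2 :=
        lintegral_neg_eq_self (fun x => ‖𝓕 q x‖ₑ ^ 2)
    _ ≤ ∫⁻ ξ, ‖q ξ‖ₑ ^ 2 := lintegral_fourier_sq_le hq.1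
    _ ≤ ∫⁻ ξ, ‖𝓕 (complexify φ : R3 → ℂ) ξ‖ₑ ^ 2 := by
        refine lintegral_mono fun ξ => ?_
        gcongr
        rw [← ofReal_norm, ← ofReal_norm]
        exact ENNReal.ofReal_le_ofReal (hqle ξ)
    _ ≤ _ := lintegral_fourier_sq_le (complexify φ).continuous.aestronglyMeasurable

/-- The second-order Riesz transforms `φ ↦ λ x_j/|x|³ ∗ ∂_k φ` are contractions of `L²`. -/
lemma eLpNorm_coulombField_partialDeriv_le (φ : 𝓢(R3, ℝ)) (j k : Fin 3) :
    eLpNorm (fun x => coulombField (fun x => fderiv ℝ φ x (EuclideanSpace.single k 1)) x j)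
      2 volume ≤ eLpNorm φ 2 volume := by
  have hfun : (fun x => fderiv ℝ φ x (EuclideanSpace.single k 1)) = partialDeriv φ k :=
    funext fun x => (partialDeriv_apply φ k x).symm
  rw [hfun]
  set g := partialDeriv φ k
  obtain ⟨C, -, hC⟩ := coulombField_memLp_two
  obtain ⟨hint, -, -⟩ := hC g g.continuous.stronglyMeasurable (g.memLp _ _)
  have hnorm : eLpNorm (fun x => coulombField g x j) 2 volume
      = eLpNorm (fun x => ((coulombField g x j : ℝ) : ℂ)) 2 volume :=
    eLpNorm_congr_norm_ae (ae_of_all _ fun x => by rw [Complex.norm_real])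
  rw [hnorm]
  -- By Fatou, the uniform `L²` bound survives pointwise convergence. The latter holds wherever the
  -- unregularized convolution converges absolutely, which is almost everywhere by
  -- `coulombField_memLp_two`.
  refine Lp.eLpNorm_le_of_ae_tendsto (u := atTop)
    (f := fun n x => ∫ y, complexify g y * regCoulomb n j (x - y))
    (Eventually.of_forall fun n => (eLpNorm_regCoulomb_conv_partialDeriv_le φ n j k).2)
    (fun n => (eLpNorm_regCoulomb_conv_partialDeriv_le φ n j k).1.aestronglyMeasurable) ?_
  filter_upwards [hint] with x hx
  have hlim : ((coulombField g x j : ℝ) : ℂ)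
      = ∫ y, complexify g y * ((coulomb (x - y) j : ℝ) : ℂ) := by
    have h1 : coulombField g x j = ∫ y, (g y • coulomb (x - y)) j :=
      ((EuclideanSpace.proj (𝕜 := ℝ) j).integral_comp_comm hx).symm
    rw [h1, ← integral_complex_ofReal]
    refine integral_congr_ae (ae_of_all _ fun y => ?_)
    simp [complexify_apply]
  rw [hlim]
  refine tendsto_integral_of_dominated_convergence (fun y => ‖g y • coulomb (x - y)‖) ?_ hx.norm ?_ ?_
  · intro n
    refine (complexify g).continuous.aestronglyMeasurable.mul ?_
    exact ((integrable_regCoulomb n j).comp_sub_left x).1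
  · intro n
    refine ae_of_all _ fun y => ?_
    rw [norm_mul, norm_smul, complexify_apply, Complex.norm_real]
    gcongr
    exact norm_regCoulomb_le n j _
  · exact ae_of_all _ fun y => (tendsto_regCoulomb j (x - y)).const_mul _

/-! ### Duality bounds for the flux and its Coulomb field. -/

lemma abs_integral_mul_le_eLpNorm_two {α : Type*} [MeasurableSpace α] {μ : Measure α} {f g : α → ℝ}
    (hf : MemLp f 2 μ) (hg : MemLp g 2 μ) :
    |∫ x, f x * g x ∂μ| ≤ (eLpNorm f 2 μ).toReal * (eLpNorm g 2 μ).toReal := by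
  have h : ‖∫ x, f x * g x ∂μ‖ₑ ≤ eLpNorm f 2 μ * eLpNorm g 2 μ := by
    refine (enorm_integral_le_lintegral_enorm _).trans ?_
    simp only [enorm_mul]
    exact lintegral_mul_le_eLpNorm_two hf.1 hg.1
  have := ENNReal.toReal_mono (ENNReal.mul_ne_top hf.eLpNorm_ne_top hg.eLpNorm_ne_top) h
  rwa [ENNReal.toReal_mul, toReal_enorm, Real.norm_eq_abs] at this

/-- The `L²` norm of a function is determined by its pairings with Schwartz functions. -/
lemma eLpNorm_two_le_of_forall_schwartz {f : R3 → ℝ} (hf : MemLp f 2 volume) {M : ℝ} (hM : 0 ≤ M)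
    (h : ∀ φ : 𝓢(R3, ℝ), |∫ x, f x * φ x| ≤ M * (eLpNorm φ 2 volume).toReal) :
    (eLpNorm f 2 volume).toReal ≤ M := by
  have key : ∀ G : Lp ℝ 2 (volume : Measure R3), |inner ℝ (hf.toLp f) G| ≤ M * ‖G‖ := by
    intro G
    refine DenseRange.induction_on (p := fun G => |inner ℝ (hf.toLp f) G| ≤ M * ‖G‖)
      (SchwartzMap.denseRange_toLpCLM (E := R3) (F := ℝ) (p := 2) (μ := volume)
        ENNReal.ofNat_ne_top) G ?_ ?_
    · exact isClosed_le (by fun_prop) (by fun_prop)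
    · intro φ
      rw [SchwartzMap.toLpCLM_apply, SchwartzMap.norm_toLp, L2.inner_def]
      refine le_trans (le_of_eq ?_) (h φ)
      congr 1
      refine integral_congr_ae ?_
      filter_upwards [hf.coeFn_toLp, φ.coeFn_toLp 2 volume] with x h1 h2
      rw [h1, h2]
      simp [mul_comm]
  -- By density `f` itself is an admissible test function, so `‖f‖² ≤ M ‖f‖`.
  have h1 := key (hf.toLp f)
  rw [real_inner_self_eq_norm_sq, abs_of_nonneg (by positivity), Lp.norm_toLp] at h1
  rcases eq_or_lt_of_le (ENNReal.toReal_nonneg (a := eLpNorm f 2 volume)) with h0 | h0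
  · rw [← h0]; exact hM
  · nlinarith

lemma memLp_component (F : L2Field) (k : Fin 3) : MemLp (fun x => F x k) 2 volume :=
  (EuclideanSpace.proj (𝕜 := ℝ) k).comp_memLp' (Lp.memLp F)

/-- The bound of the flux `∫₀ᵗ s ∫ (Γ[E] w)(x - s v, v, t - s) dv ds`. -/
lemma IsFlux.eLpNorm_component_le {w : ℝ → L2Phase} {E : ℝ → R3 → R3} {t A : ℝ} {F : L2Field}
    (hF : IsFlux w E t F) (ht : 0 < t) (hE : ∀ r, StronglyMeasurable (E r))
    (hw : ∀ s ∈ Ioo 0 t, ‖w (t - s)‖ = A) {N : ℝ → ℝ} (hN0 : ∀ s ∈ Ioo 0 t, 0 ≤ N s)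
    (hN : ∀ s ∈ Ioo 0 t, eLpNorm (E (t - s)) 2 volume ≤ ENNReal.ofReal (N s))
    (hint : IntegrableOn (fun s => s ^ (-(1 / 2) : ℝ) * N s) (Ioo 0 t)) (k : Fin 3) :
    (eLpNorm (fun x => F x k) 2 volume).toReal
      ≤ A * ∫ s in Ioo 0 t, s ^ (-(1 / 2) : ℝ) * N s := by
  have hA : 0 ≤ A := by
    rw [← hw (t / 2) ⟨by linarith, by linarith⟩]; exact norm_nonneg _
  refine eLpNorm_two_le_of_forall_schwartz (memLp_component F k)
    (mul_nonneg hA (setIntegral_nonneg measurableSet_Ioo fun s hs =>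
      mul_nonneg (Real.rpow_nonneg hs.1.le _) (hN0 s hs))) fun φ => ?_
  set P := (eLpNorm φ 2 volume).toReal
  obtain ⟨-, heq⟩ := hF φ k
  have hnorm := congrArg norm heq
  rw [Complex.norm_real, Real.norm_eq_abs] at hnorm
  rw [hnorm, intervalIntegral.integral_of_le ht.le, integral_Ioc_eq_integral_Ioo]
  refine (norm_integral_le_of_norm_le ((hint.const_mul A).mul_const P) ?_).trans (le_of_eq ?_)
  · filter_upwards [ae_restrict_mem measurableSet_Ioo] with s hs
    have hP : eLpNorm φ 2 volume = ENNReal.ofReal P :=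
      (ENNReal.ofReal_toReal (φ.memLp 2 volume).eLpNorm_ne_top).symm
    have hwA : eLpNorm (w (t - s)) 2 volume = ENNReal.ofReal A := by
      rw [← hw s hs, ofReal_norm, Lp.enorm_def]
    have hg := enorm_gammaPair_le (hE (t - s)) φ.continuous k hs.1
      (Lp.aestronglyMeasurable (w (t - s)))
    have hg2 : ‖gammaPair (E (t - s)) k (w (t - s)) (fun x v => ((φ (x + s • v) : ℝ) : ℂ))‖
        ≤ A * (N s * (s ^ (-(3 / 2) : ℝ) * P)) := by
      rw [← ENNReal.ofReal_le_ofReal_iff (mul_nonneg hA (mul_nonneg (hN0 s hs)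
        (mul_nonneg (Real.rpow_nonneg hs.1.le _) ENNReal.toReal_nonneg))), ofReal_norm,
        ENNReal.ofReal_mul hA, ENNReal.ofReal_mul (hN0 s hs),
        ENNReal.ofReal_mul (Real.rpow_nonneg hs.1.le _), ← hwA, ← hP]
      refine hg.trans ?_
      gcongr
      exact hN s hs
    rw [norm_mul, Complex.norm_real, Real.norm_of_nonneg hs.1.le]
    refine (mul_le_mul_of_nonneg_left hg2 hs.1.le).trans (le_of_eq ?_)
    have : s ^ (-(1 / 2) : ℝ) = s * s ^ (-(3 / 2) : ℝ) := by
      nth_rewrite 2 [← Real.rpow_one s]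
      rw [← Real.rpow_add hs.1]; norm_num
    rw [this]
    ring
  · rw [integral_mul_const, integral_const_mul]

/-- `div` followed by the Coulomb field is bounded on `L²`. -/
lemma IsCoulombDiv.norm_le {F G : L2Field} (h : IsCoulombDiv F G) {M : ℝ}
    (hF : ∀ k, (eLpNorm (fun x => F x k) 2 volume).toReal ≤ M) : ‖G‖ ≤ 9 * M := by
  have hM : 0 ≤ M := ENNReal.toReal_nonneg.trans (hF 0)
  -- Three contractions, one for each `k`, act in every component of `G`; adding the three
  -- components gives `9 = 3 · 3`.
  have hG : ∀ j, (eLpNorm (fun x => G x j) 2 volume).toReal ≤ 3 * M := by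
    intro j
    refine eLpNorm_two_le_of_forall_schwartz (memLp_component G j) (by positivity) fun φ => ?_
    rw [h φ j]
    refine (Finset.abs_sum_le_sum_abs _ _).trans ?_
    calc _ ≤ ∑ _k : Fin 3, M * (eLpNorm φ 2 volume).toReal := by
          refine Finset.sum_le_sum fun k _ => ?_
          have hle := eLpNorm_coulombField_partialDeriv_le φ j k
          have hφ := (φ.memLp 2 volume).eLpNorm_ne_top
          have hmeas : AEStronglyMeasurable (fun x =>
              coulombField (fun x => fderiv ℝ φ x (EuclideanSpace.single k 1)) x j) volume := by
            have hfun : (fun x => fderiv ℝ φ x (EuclideanSpace.single k 1)) = partialDeriv φ k :=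
              funext fun x => (partialDeriv_apply φ k x).symm
            rw [hfun]
            exact ((EuclideanSpace.proj (𝕜 := ℝ) j).continuous.comp_stronglyMeasurable
              (stronglyMeasurable_coulombField
                (partialDeriv φ k).continuous.stronglyMeasurable)).aestronglyMeasurable
          refine (abs_integral_mul_le_eLpNorm_two (memLp_component F k)
            ⟨hmeas, hle.trans_lt hφ.lt_top⟩).trans ?_
          gcongr
          · exact hF k
      _ = _ := by simp; ring
  have hsum : eLpNorm G 2 volume ≤ ∑ j : Fin 3, eLpNorm (fun x => G x j) 2 volume := by
    have hle : eLpNorm G 2 volume ≤ eLpNorm (∑ j : Fin 3, fun x => ‖G x j‖) 2 volume := by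
      refine eLpNorm_mono_real fun x => ?_
      rw [Finset.sum_apply, EuclideanSpace.norm_eq]
      refine Real.sqrt_le_iff.2 ⟨by positivity, ?_⟩
      exact Finset.sum_sq_le_sq_sum_of_nonneg fun i _ => norm_nonneg _
    refine hle.trans ((eLpNorm_sum_le (fun j _ => (memLp_component G j).1.norm) one_le_two).trans
      (le_of_eq ?_))
    exact Finset.sum_congr rfl fun j _ => eLpNorm_norm _
  rw [Lp.norm_def]
  have h1 := ENNReal.toReal_mono
    (ENNReal.sum_ne_top.2 fun j _ => (memLp_component G j).eLpNorm_ne_top) hsum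
  rw [ENNReal.toReal_sum fun j _ => (memLp_component G j).eLpNorm_ne_top] at h1
  refine h1.trans ((Finset.sum_le_sum fun j _ => hG j).trans (le_of_eq ?_))
  simp
  ring

/-! ### The singular Grönwall inequality. -/

/-- Grönwall's inequality in integral form. -/
lemma le_mul_exp_of_le_add_mul_integral {Y : ℝ → ℝ} (hY : Continuous Y) (hY0 : ∀ τ, 0 ≤ τ → 0 ≤ Y τ)
    {G L t : ℝ} (ht : 0 ≤ t) (hL : 0 ≤ L)
    (h : ∀ τ ∈ Icc 0 t, Y τ ≤ G + L * ∫ r in (0 : ℝ)..τ, Y r) : Y t ≤ G * Real.exp (L * t) := by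
  let u : ℝ → ℝ := fun τ => ∫ r in (0 : ℝ)..τ, Y r
  have hu : ∀ τ, HasDerivAt u (Y τ) τ := fun τ => (hY.integral_hasStrictDerivAt 0 τ).hasDerivAt
  have hu0 : ∀ τ, 0 ≤ τ → 0 ≤ u τ := fun τ hτ =>
    intervalIntegral.integral_nonneg hτ fun r hr => hY0 r hr.1
  -- The differential Grönwall inequality is applied to the primitive `u`, which satisfies `u' ≤ G +
  -- L u` and `u(0) = 0`; its bound is then inserted back into `h`.
  have hg := norm_le_gronwallBound_of_norm_deriv_right_le (f := u) (f' := Y) (δ := 0) (K := L)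
    (ε := G) (a := 0) (b := t)
    (fun τ _ => (hu τ).continuousAt.continuousWithinAt) (fun τ _ => (hu τ).hasDerivWithinAt)
    (by simp [u]) (fun τ hτ => by
      rw [Real.norm_of_nonneg (hY0 τ hτ.1), Real.norm_of_nonneg (hu0 τ hτ.1), add_comm]
      exact h τ ⟨hτ.1, hτ.2.le⟩) t ⟨ht, le_rfl⟩
  rw [Real.norm_of_nonneg (hu0 t ht), sub_zero] at hg
  refine (h t ⟨ht, le_rfl⟩).trans ((add_le_add_right (mul_le_mul_of_nonneg_left hg hL) G).trans
    (le_of_eq ?_))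
  rcases eq_or_ne L 0 with rfl | hL0
  · simp
  · rw [gronwallBound_of_K_ne_0 hL0]
    field_simp
    ring

lemma setLIntegral_sub_rpow {β q t : ℝ} (hβ : β < 1) (hqt : q < t) :
    ∫⁻ r in Ioo q t, ENNReal.ofReal ((r - q) ^ (-β))
      = ENNReal.ofReal ((t - q) ^ (1 - β) / (1 - β)) := by
  have hi : IntervalIntegrable (fun r => (r - q) ^ (-β)) volume q t := by
    have := (intervalIntegral.intervalIntegrable_rpow' (a := 0) (b := t - q)
      (show -1 < -β by linarith)).comp_sub_right q
    simpa using this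
  have hI := (intervalIntegrable_iff_integrableOn_Ioo_of_le hqt.le).1 hi
  rw [← ofReal_integral_eq_lintegral_ofReal hI, ← integral_Ioc_eq_integral_Ioo,
    ← intervalIntegral.integral_of_le hqt.le,
    intervalIntegral.integral_comp_sub_right (fun r => r ^ (-β)), sub_self,
    integral_rpow (Or.inl (by linarith)), Real.zero_rpow (by linarith)]
  · ring_nf
  · filter_upwards [ae_restrict_mem measurableSet_Ioo] with r hr
    exact Real.rpow_nonneg (by linarith [hr.1]) _

lemma setLIntegral_sub_rpow' {α q t : ℝ} (hα : α < 1) (hqt : q < t) :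
    ∫⁻ r in Ioo q t, ENNReal.ofReal ((t - r) ^ (-α))
      = ENNReal.ofReal ((t - q) ^ (1 - α) / (1 - α)) := by
  have h := setLIntegral_sub_rpow hα hqt
  rw [← h, ← lintegral_indicator measurableSet_Ioo, ← lintegral_indicator measurableSet_Ioo,
    ← lintegral_sub_left_eq_self _ (q + t)]
  refine lintegral_congr fun r => ?_
  by_cases hr : r ∈ Ioo q t
  · have hr' : q + t - r ∈ Ioo q t := ⟨by linarith [hr.2], by linarith [hr.1]⟩
    rw [indicator_of_mem hr, indicator_of_mem hr']
    congr 2; ring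
  · have hr' : q + t - r ∉ Ioo q t := fun h => hr ⟨by linarith [h.2], by linarith [h.1]⟩
    rw [indicator_of_notMem hr, indicator_of_notMem hr']

/-- A bound for the Beta integral. -/
lemma setLIntegral_beta_le {α β q t : ℝ} (hα0 : 0 ≤ α) (hα : α < 1) (hβ0 : 0 ≤ β) (hβ : β < 1)
    (hqt : q < t) :
    ∫⁻ r in Ioo q t, ENNReal.ofReal ((t - r) ^ (-α)) * ENNReal.ofReal ((r - q) ^ (-β))
      ≤ ENNReal.ofReal ((2 / (1 - α) + 2 / (1 - β)) * (t - q) ^ (1 - α - β)) := by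
  set d := t - q with hd
  have hd0 : 0 < d := by linarith
  have hα' : 0 < 1 - α := by linarith
  have hβ' : 0 < 1 - β := by linarith
  -- At least one of `r - q` and `t - r` is `≥ d/2`, so only one factor is singular at a time.
  have hpt : ∀ r ∈ Ioo q t, ENNReal.ofReal ((t - r) ^ (-α)) * ENNReal.ofReal ((r - q) ^ (-β))
      ≤ ENNReal.ofReal ((d / 2) ^ (-β)) * ENNReal.ofReal ((t - r) ^ (-α)) +
        ENNReal.ofReal ((d / 2) ^ (-α)) * ENNReal.ofReal ((r - q) ^ (-β)) := by
    intro r hr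
    rcases le_total (d / 2) (r - q) with h | h
    · refine le_trans ?_ le_self_add
      rw [mul_comm]
      gcongr ENNReal.ofReal ?_ * _
      exact Real.rpow_le_rpow_of_nonpos (by positivity) h (by linarith)
    · refine le_trans ?_ le_add_self
      refine mul_le_mul_left (ENNReal.ofReal_le_ofReal ?_) _
      exact Real.rpow_le_rpow_of_nonpos (show 0 < d / 2 by positivity)
        (show d / 2 ≤ t - r by linarith) (by linarith)
  have hhalf : ∀ γ : ℝ, 0 ≤ γ → γ < 1 → (d / 2) ^ (-γ) ≤ 2 * d ^ (-γ) := by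
    intro γ hγ hγ1
    rw [Real.div_rpow hd0.le zero_le_two, Real.rpow_neg zero_le_two, div_inv_eq_mul, mul_comm]
    gcongr
    calc (2 : ℝ) ^ γ ≤ 2 ^ (1 : ℝ) := Real.rpow_le_rpow_of_exponent_le one_le_two hγ1.le
      _ = 2 := Real.rpow_one 2
  calc _ ≤ ∫⁻ r in Ioo q t, (ENNReal.ofReal ((d / 2) ^ (-β)) * ENNReal.ofReal ((t - r) ^ (-α)) +
        ENNReal.ofReal ((d / 2) ^ (-α)) * ENNReal.ofReal ((r - q) ^ (-β))) :=
        setLIntegral_mono' measurableSet_Ioo hpt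
    _ = ENNReal.ofReal ((d / 2) ^ (-β) * (d ^ (1 - α) / (1 - α)) +
          (d / 2) ^ (-α) * (d ^ (1 - β) / (1 - β))) := by
        rw [lintegral_add_left (by fun_prop), lintegral_const_mul _ (by fun_prop),
          lintegral_const_mul _ (by fun_prop), setLIntegral_sub_rpow hβ hqt,
          setLIntegral_sub_rpow' hα hqt, ← ENNReal.ofReal_mul (by positivity),
          ← ENNReal.ofReal_mul (by positivity), ← ENNReal.ofReal_add (by positivity) (by positivity)]
    _ ≤ _ := by
        apply ENNReal.ofReal_le_ofReal
        calc _ ≤ (2 * d ^ (-β)) * (d ^ (1 - α) / (1 - α)) +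
              (2 * d ^ (-α)) * (d ^ (1 - β) / (1 - β)) := by
              gcongr
              · exact hhalf β hβ0 hβ
              · exact hhalf α hα0 hα
          _ = 2 / (1 - α) * (d ^ (-β) * d ^ (1 - α)) + 2 / (1 - β) * (d ^ (-α) * d ^ (1 - β)) := by
              ring
          _ = _ := by
              rw [← Real.rpow_add hd0, ← Real.rpow_add hd0, show -β + (1 - α) = 1 - α - β by ring,
                show -α + (1 - β) = 1 - α - β by ring]
              ring

/-- The kernel `|t - r|^{-1/2}` of the Volterra equation, applied twice, is bounded. -/
lemma lintegral_abel_abel_le {H : ℝ → ℝ≥0∞} (hH : Measurable H) (t : ℝ) :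
    ∫⁻ r in Ioo 0 t, ENNReal.ofReal ((t - r) ^ (-(1 / 2) : ℝ)) *
        ∫⁻ q in Ioo 0 r, ENNReal.ofReal ((r - q) ^ (-(1 / 2) : ℝ)) * H q
      ≤ ENNReal.ofReal 8 * ∫⁻ q in Ioo 0 t, H q := by
  -- Tonelli on this triangle leaves the inner Beta integral with both exponents `1/2`: its power of
  -- `t - q` is zero, and its constant is `4 + 4 = 8`.
  let S : Set (ℝ × ℝ) := {p | 0 < p.2 ∧ p.2 < p.1 ∧ p.1 < t}
  have hS : MeasurableSet S :=
    (measurableSet_lt measurable_const measurable_snd).inter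
      ((measurableSet_lt measurable_snd measurable_fst).inter
        (measurableSet_lt measurable_fst measurable_const))
  let Φ : ℝ × ℝ → ℝ≥0∞ := S.indicator fun p => ENNReal.ofReal ((t - p.1) ^ (-(1 / 2) : ℝ)) *
    (ENNReal.ofReal ((p.1 - p.2) ^ (-(1 / 2) : ℝ)) * H p.2)
  have hΦ : Measurable Φ := Measurable.indicator (by fun_prop) hS
  calc _ = ∫⁻ r, ∫⁻ q, Φ (r, q) := by
        rw [← lintegral_indicator measurableSet_Ioo]
        refine lintegral_congr fun r => ?_
        by_cases hr : r ∈ Ioo 0 t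
        · rw [indicator_of_mem hr, ← lintegral_indicator measurableSet_Ioo,
            ← lintegral_const_mul _ (Measurable.indicator (by fun_prop) measurableSet_Ioo)]
          refine lintegral_congr fun q => ?_
          by_cases hq : q ∈ Ioo 0 r
          · have : (r, q) ∈ S := ⟨hq.1, hq.2, hr.2⟩
            simp only [Φ, indicator_of_mem this, indicator_of_mem hq]
          · have : (r, q) ∉ S := fun h => hq ⟨h.1, h.2.1⟩
            simp only [Φ, indicator_of_notMem this, indicator_of_notMem hq, mul_zero]
        · rw [indicator_of_notMem hr]
          symm
          refine (lintegral_congr fun q => ?_).trans lintegral_zero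
          exact indicator_of_notMem (fun h => hr ⟨h.1.trans h.2.1, h.2.2⟩) _
    _ = ∫⁻ q, ∫⁻ r, Φ (r, q) := lintegral_lintegral_swap (f := fun r q => Φ (r, q)) hΦ.aemeasurable
    _ ≤ ∫⁻ q, (Ioo 0 t).indicator (fun q => ENNReal.ofReal 8 * H q) q := by
        refine lintegral_mono fun q => ?_
        simp only
        by_cases hq : q ∈ Ioo 0 t
        · have hb : ∫⁻ r in Ioo q t, ENNReal.ofReal ((t - r) ^ (-(1 / 2) : ℝ)) *
              ENNReal.ofReal ((r - q) ^ (-(1 / 2) : ℝ)) ≤ ENNReal.ofReal 8 := by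
            refine (setLIntegral_beta_le (by norm_num) (by norm_num) (by norm_num) (by norm_num)
              hq.2).trans (le_of_eq ?_)
            norm_num
          rw [indicator_of_mem hq]
          refine le_trans (le_of_eq ?_) (mul_le_mul_left hb (H q))
          rw [← lintegral_indicator measurableSet_Ioo,
            ← lintegral_mul_const _ (Measurable.indicator (by fun_prop) measurableSet_Ioo)]
          refine lintegral_congr fun r => ?_
          by_cases hr : r ∈ Ioo q t
          · have : (r, q) ∈ S := ⟨hq.1, hr.1, hr.2⟩
            simp only [Φ, indicator_of_mem this, indicator_of_mem hr]
            rw [mul_assoc]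
          · have : (r, q) ∉ S := fun h => hr ⟨h.2.1, h.2.2⟩
            simp only [Φ, indicator_of_notMem this, indicator_of_notMem hr, zero_mul]
        · rw [indicator_of_notMem hq]
          refine le_of_eq ((lintegral_congr fun r => ?_).trans lintegral_zero)
          exact indicator_of_notMem (fun h => hq ⟨h.1, h.2.1.trans h.2.2⟩) _
    _ = _ := by
        rw [lintegral_indicator measurableSet_Ioo, lintegral_const_mul _ hH]

/-- The constant in the singular Grönwall inequality. -/
def volterraConst (ω a b T : ℝ) : ℝ :=
  b * (a * (4 + 2 / (1 - ω))) + b * (b * (8 * (a * (T ^ (1 / 2 : ℝ) / (1 - ω)))))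

/-- The singular Grönwall inequality for the Volterra inequality with kernel `(t - r)^{-1/2}`. -/
lemma le_of_volterra {ω a b T : ℝ} (hω0 : 0 ≤ ω) (hω : ω < 1) (ha : 0 ≤ a) (hb : 0 ≤ b)
    {e : ℝ → ℝ} (hem : Measurable e) (he0 : ∀ r, 0 ≤ e r) (hei : Integrable e)
    (h : ∀ t ∈ Ioc 0 T, ENNReal.ofReal (e t) ≤ ENNReal.ofReal b *
      ∫⁻ r in Ioo 0 t, ENNReal.ofReal ((t - r) ^ (-(1 / 2) : ℝ)) *
        ENNReal.ofReal (a * r ^ (-ω) + e r)) :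
    ∀ t ∈ Ioc 0 T, e t ≤ volterraConst ω a b T *
      (1 + 2 * (8 * b ^ 2) * T * Real.exp (8 * b ^ 2 * T)) * t ^ (1 / 2 - ω) := by
  have hω' : 0 < 1 - ω := by linarith
  set D := volterraConst ω a b T with hD
  -- Grönwall is run on the primitive of `e`, which is continuous, whereas `e` may blow up at `0`
  -- when `ω > 1/2`.
  let Y : ℝ → ℝ := fun t => ∫ r in (0 : ℝ)..t, e r
  have hY : Continuous Y := intervalIntegral.continuous_primitive
    (fun _ _ => hei.intervalIntegrable) 0
  have hY0 : ∀ t, 0 ≤ t → 0 ≤ Y t := fun t ht =>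
    intervalIntegral.integral_nonneg ht fun r _ => he0 r
  -- The inequality is inserted once into itself. The double Abel kernel is bounded by `8`, so `e`
  -- survives only through `Y`; the resulting source `t^{1-ω}` is absorbed into `T^{1/2} t^{1/2-ω}`.
  have hpt : ∀ t ∈ Ioc 0 T, e t ≤ D * t ^ (1 / 2 - ω) + 8 * b ^ 2 * Y t := by
    intro t ht
    have ht0 : 0 < t := ht.1
    have hT0 : 0 < T := ht0.trans_le ht.2
    let H : ℝ → ℝ≥0∞ := fun r => ENNReal.ofReal (a * r ^ (-ω) + e r)
    have hH : Measurable H := by fun_prop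
    have h1 : ∫⁻ r in Ioo 0 t, ENNReal.ofReal ((t - r) ^ (-(1 / 2) : ℝ)) *
        ENNReal.ofReal (a * r ^ (-ω))
        ≤ ENNReal.ofReal (a * ((4 + 2 / (1 - ω)) * t ^ (1 / 2 - ω))) := by
      have hbeta := setLIntegral_beta_le (α := 1 / 2) (β := ω) (by norm_num) (by norm_num) hω0 hω ht0
      simp only [sub_zero] at hbeta
      calc _ = ENNReal.ofReal a * ∫⁻ r in Ioo 0 t, ENNReal.ofReal ((t - r) ^ (-(1 / 2) : ℝ)) *
            ENNReal.ofReal (r ^ (-ω)) := by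
            rw [← lintegral_const_mul _ (by fun_prop)]
            refine lintegral_congr fun r => ?_
            rw [ENNReal.ofReal_mul ha]; ring
        _ ≤ _ := by
            rw [ENNReal.ofReal_mul ha]
            gcongr
            refine hbeta.trans (le_of_eq ?_)
            norm_num
    have hint : ∫⁻ q in Ioo 0 t, H q
        = ENNReal.ofReal (a * (t ^ (1 - ω) / (1 - ω)) + Y t) := by
      have hr := setLIntegral_sub_rpow hω ht0
      simp only [sub_zero] at hr
      calc ∫⁻ q in Ioo 0 t, H q = ∫⁻ q in Ioo 0 t, (ENNReal.ofReal a * ENNReal.ofReal (q ^ (-ω)) +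
            ENNReal.ofReal (e q)) := by
            refine setLIntegral_congr_fun measurableSet_Ioo fun q hq => ?_
            simp only [H]
            rw [ENNReal.ofReal_add (mul_nonneg ha (Real.rpow_nonneg hq.1.le _)) (he0 q),
              ENNReal.ofReal_mul ha]
        _ = _ := by
            rw [lintegral_add_left (by fun_prop), lintegral_const_mul _ (by fun_prop), hr,
              ← ofReal_integral_eq_lintegral_ofReal hei.integrableOn (ae_of_all _ he0),
              ← integral_Ioc_eq_integral_Ioo, ← intervalIntegral.integral_of_le ht0.le,
              ← ENNReal.ofReal_mul ha, ← ENNReal.ofReal_add (by positivity) (hY0 t ht0.le)]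
    have h2 : ∫⁻ r in Ioo 0 t, ENNReal.ofReal ((t - r) ^ (-(1 / 2) : ℝ)) * ENNReal.ofReal (e r)
        ≤ ENNReal.ofReal b * (ENNReal.ofReal 8 * ∫⁻ q in Ioo 0 t, H q) := by
      refine le_trans ?_ (mul_le_mul_right (lintegral_abel_abel_le hH t) _)
      rw [← lintegral_const_mul' _ _ ENNReal.ofReal_ne_top]
      refine setLIntegral_mono' measurableSet_Ioo fun r hr => ?_
      rw [mul_left_comm]
      gcongr
      exact h r ⟨hr.1, hr.2.le.trans ht.2⟩
    have h3 : ENNReal.ofReal (e t) ≤ ENNReal.ofReal (b *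
        (a * ((4 + 2 / (1 - ω)) * t ^ (1 / 2 - ω)) +
          b * (8 * (a * (t ^ (1 - ω) / (1 - ω)) + Y t)))) := by
      refine (h t ht).trans ?_
      rw [ENNReal.ofReal_mul hb, ENNReal.ofReal_add (by positivity)
        (by have := hY0 t ht0.le; positivity), ENNReal.ofReal_mul (p := b) hb,
        ENNReal.ofReal_mul (p := 8) (by norm_num)]
      gcongr
      rw [← hint]
      calc _ = ∫⁻ r in Ioo 0 t, (ENNReal.ofReal ((t - r) ^ (-(1 / 2) : ℝ)) *
            ENNReal.ofReal (a * r ^ (-ω)) +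
            ENNReal.ofReal ((t - r) ^ (-(1 / 2) : ℝ)) * ENNReal.ofReal (e r)) := by
            refine setLIntegral_congr_fun measurableSet_Ioo fun r hr => ?_
            rw [ENNReal.ofReal_add (mul_nonneg ha (Real.rpow_nonneg hr.1.le _)) (he0 r), mul_add]
        _ ≤ _ := by
            rw [lintegral_add_left (by fun_prop)]
            exact add_le_add h1 h2
    have hnn := hY0 t ht0.le
    rw [ENNReal.ofReal_le_ofReal_iff (by positivity)] at h3
    refine h3.trans ?_
    have ht1 : t ^ (1 - ω) ≤ T ^ (1 / 2 : ℝ) * t ^ (1 / 2 - ω) := by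
      rw [show 1 - ω = 1 / 2 + (1 / 2 - ω) by ring, Real.rpow_add ht0]
      gcongr
      exact ht.2
    calc _ ≤ b * (a * ((4 + 2 / (1 - ω)) * t ^ (1 / 2 - ω)) +
          b * (8 * (a * (T ^ (1 / 2 : ℝ) * t ^ (1 / 2 - ω) / (1 - ω)) + Y t))) := by gcongr
      _ = _ := by rw [hD, volterraConst]; ring
  intro t ht
  have ht0 : 0 < t := ht.1
  have hT0 : 0 < T := ht0.trans_le ht.2
  have hD0 : 0 ≤ D := by rw [hD, volterraConst]; positivity
  set L := 8 * b ^ 2 with hL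
  have hL0 : 0 ≤ L := by positivity
  have hYt : Y t ≤ D * (t ^ (3 / 2 - ω) / (3 / 2 - ω)) * Real.exp (L * t) := by
    refine le_mul_exp_of_le_add_mul_integral hY hY0 ht0.le hL0 fun τ hτ => ?_
    have hpow : IntervalIntegrable (fun r : ℝ => r ^ (1 / 2 - ω)) volume 0 τ :=
      intervalIntegral.intervalIntegrable_rpow' (by linarith)
    calc Y τ ≤ ∫ r in (0 : ℝ)..τ, (D * r ^ (1 / 2 - ω) + L * Y r) := by
          refine intervalIntegral.integral_mono_on_of_le_Ioo hτ.1 hei.intervalIntegrable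
            ((hpow.const_mul D).add ((hY.intervalIntegrable _ _).const_mul L)) fun r hr => ?_
          exact hpt r ⟨hr.1, (hr.2.le.trans hτ.2).trans ht.2⟩
      _ = D * (τ ^ (3 / 2 - ω) / (3 / 2 - ω)) + L * ∫ r in (0 : ℝ)..τ, Y r := by
          rw [intervalIntegral.integral_add (hpow.const_mul D)
            ((hY.intervalIntegrable _ _).const_mul L), intervalIntegral.integral_const_mul,
            intervalIntegral.integral_const_mul, integral_rpow (Or.inl (by linarith)),
            Real.zero_rpow (by linarith)]
          norm_num
          left
          ring_nf
      _ ≤ _ := by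
          have h32 : 0 ≤ 3 / 2 - ω := by linarith
          gcongr
          · exact hτ.1
          · exact hτ.2
  have h32 : t ^ (3 / 2 - ω) / (3 / 2 - ω) ≤ 2 * T * t ^ (1 / 2 - ω) := by
    rw [show 3 / 2 - ω = 1 + (1 / 2 - ω) by ring, Real.rpow_add ht0, Real.rpow_one,
      div_le_iff₀ (by linarith)]
    have hp : 0 < t ^ (1 / 2 - ω) := Real.rpow_pos_of_pos ht0 _
    have h1 : t * t ^ (1 / 2 - ω) ≤ T * t ^ (1 / 2 - ω) := by gcongr; exact ht.2
    -- Here `ω < 1` gives `3/2 - ω > 1/2`, the origin of the factor `2` in the final constant.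
    have h2 : T * t ^ (1 / 2 - ω) * 1 ≤ T * t ^ (1 / 2 - ω) * (2 * (1 + (1 / 2 - ω))) := by
      gcongr; linarith
    nlinarith
  calc e t ≤ D * t ^ (1 / 2 - ω) + L * Y t := hpt t ht
    _ ≤ D * t ^ (1 / 2 - ω) + L * (D * (2 * T * t ^ (1 / 2 - ω)) * Real.exp (L * T)) := by
        gcongr
        refine hYt.trans ?_
        gcongr
        exact ht.2
    _ = _ := by ring

lemma continuous_gronwallConst (ω a b : ℝ) : Continuous fun T : ℝ => volterraConst ω a b T *
    (1 + 2 * (8 * b ^ 2) * T * Real.exp (8 * b ^ 2 * T)) := by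
  have : Continuous fun T : ℝ => T ^ (1 / 2 : ℝ) :=
    continuous_id.rpow_const fun _ => Or.inr (by norm_num)
  unfold volterraConst
  fun_prop

/-! ### The Volterra inequality for `E₁`. -/

lemma stronglyMeasurable_totalField (w : ℝ → L2Phase) (E1 : ℝ → L2Field) (t : ℝ) :
    StronglyMeasurable (totalField w E1 t) :=
  (stronglyMeasurable_coulombField
    (stronglyMeasurable_freeDensity (Lp.stronglyMeasurable (w 0)) t)).add
    (Lp.stronglyMeasurable (E1 t))

/-- Products of `s^{-1/2}` with an integrable function that is continuous away from the other
endpoint are integrable. -/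
lemma integrableOn_abel_kernel_mul {h : ℝ → ℝ} {t : ℝ} (ht : 0 < t) (hc : ContinuousOn h (Ioc 0 t))
    (hi : IntegrableOn h (Ioc 0 t)) :
    IntegrableOn (fun s => s ^ (-(1 / 2) : ℝ) * h (t - s)) (Ioo 0 t) := by
  have h2 : 0 ≤ t / 2 := by positivity
  -- The two factors can be singular only at opposite endpoints, so on each half of the interval one
  -- of them is continuous and the other integrable.
  have hleft : IntegrableOn (fun s => s ^ (-(1 / 2) : ℝ) * h (t - s)) (Icc 0 (t / 2)) := by
    refine IntegrableOn.mul_continuousOn ?_ ?_ isCompact_Icc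
    · rw [integrableOn_Icc_iff_integrableOn_Ioc]
      exact (intervalIntegrable_iff_integrableOn_Ioc_of_le h2).1
        (intervalIntegral.intervalIntegrable_rpow' (by norm_num))
    · refine hc.comp (by fun_prop) fun s hs => ?_
      exact ⟨by linarith [hs.2], by linarith [hs.1]⟩
  have hright : IntegrableOn (fun s => s ^ (-(1 / 2) : ℝ) * h (t - s)) (Icc (t / 2) t) := by
    refine IntegrableOn.continuousOn_mul ?_ ?_ isCompact_Icc
    · intro s hs
      have hs0 : s ≠ 0 := by have := hs.1; intro h0; linarith
      exact (Real.continuousAt_rpow_const _ _ (Or.inl hs0)).continuousWithinAt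
    · have := ((intervalIntegrable_iff_integrableOn_Ioc_of_le ht.le).2 hi).comp_sub_left t
      simp only [sub_zero, sub_self] at this
      have h3 := (intervalIntegrable_iff_integrableOn_Ioc_of_le ht.le).1 this.symm
      rw [integrableOn_Icc_iff_integrableOn_Ioc]
      exact h3.mono_set (Ioc_subset_Ioc_left h2)
  refine (hleft.union hright).mono_set fun s hs => ?_
  rcases le_total s (t / 2) with h | h
  · exact Or.inl ⟨hs.1.le, h⟩
  · exact Or.inr ⟨h, hs.2.le⟩

lemma setLIntegral_Ioo_reflect (f : ℝ → ℝ≥0∞) (t : ℝ) :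
    ∫⁻ s in Ioo 0 t, f (t - s) = ∫⁻ r in Ioo 0 t, f r := by
  rw [← lintegral_indicator measurableSet_Ioo, ← lintegral_indicator measurableSet_Ioo,
    ← lintegral_sub_left_eq_self _ t]
  refine lintegral_congr fun r => ?_
  by_cases hr : r ∈ Ioo 0 t
  · have hr' : t - r ∈ Ioo 0 t := ⟨by linarith [hr.2], by linarith [hr.1]⟩
    rw [indicator_of_mem hr, indicator_of_mem hr', sub_sub_cancel]
  · have hr' : t - r ∉ Ioo 0 t := fun h => hr ⟨by linarith [h.2], by linarith [h.1]⟩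
    rw [indicator_of_notMem hr, indicator_of_notMem hr']

/-- The Volterra inequality for `‖E₁‖₂`. -/
lemma IsMildSolution.norm_field_le {T a ω : ℝ} {w : ℝ → L2Phase} {E1 : ℝ → L2Field}
    (hsol : IsMildSolution T w E1) (hw : ∀ t ∈ Icc 0 T, ‖w t‖ = ‖w 0‖) (ha : 0 ≤ a) (hω : ω < 1)
    (hE0 : ∀ r ∈ Ioc 0 T, eLpNorm (field0 (w 0) r) 2 volume ≤ ENNReal.ofReal (a * r ^ (-ω)))
    {t : ℝ} (ht : t ∈ Ioc 0 T) :
    ENNReal.ofReal ‖E1 t‖ ≤ ENNReal.ofReal (9 * ‖w 0‖) *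
      ∫⁻ r in Ioo 0 t, ENNReal.ofReal ((t - r) ^ (-(1 / 2) : ℝ)) *
        ENNReal.ofReal (a * r ^ (-ω) + ‖E1 r‖) := by
  have ht0 : 0 < t := ht.1
  obtain ⟨F, hF, hG⟩ := hsol.field_eq t ht
  let h : ℝ → ℝ := fun r => a * r ^ (-ω) + ‖E1 r‖
  have hh0 : ∀ r, 0 < r → 0 ≤ h r := fun r hr => by
    have := Real.rpow_nonneg hr.le (-ω)
    positivity
  have hsub : Ioc 0 t ⊆ Ioc 0 T := Ioc_subset_Ioc_right ht.2
  have hc : ContinuousOn h (Ioc 0 t) := by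
    refine ContinuousOn.add (ContinuousOn.mul continuousOn_const fun r hr => ?_)
      (hsol.field_continuousOn.mono hsub).norm
    exact (Real.continuousAt_rpow_const _ _ (Or.inl hr.1.ne')).continuousWithinAt
  have hi : IntegrableOn h (Ioc 0 t) := by
    refine Integrable.add (Integrable.const_mul ?_ a) (hsol.field_integrableOn.mono_set hsub)
    exact (intervalIntegrable_iff_integrableOn_Ioc_of_le ht0.le).1
      (intervalIntegral.intervalIntegrable_rpow' (by linarith))
  have hint := integrableOn_abel_kernel_mul ht0 hc hi
  have hmem : ∀ s ∈ Ioo 0 t, t - s ∈ Ioc 0 T := fun s hs =>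
    ⟨by linarith [hs.2], by linarith [hs.1, ht.2]⟩
  have hbound := hG.norm_le fun k => hF.eLpNorm_component_le ht0
    (stronglyMeasurable_totalField w E1) (A := ‖w 0‖) (N := fun s => h (t - s))
    (fun s hs => hw _ ⟨(hmem s hs).1.le, (hmem s hs).2⟩)
    (fun s hs => hh0 _ (hmem s hs).1) (fun s hs => by
      refine (eLpNorm_add_le (stronglyMeasurable_coulombField
        (stronglyMeasurable_freeDensity (Lp.stronglyMeasurable (w 0)) _)).aestronglyMeasurable
        (Lp.aestronglyMeasurable (E1 (t - s))) one_le_two).trans ?_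
      rw [ENNReal.ofReal_add (mul_nonneg ha (Real.rpow_nonneg (hmem s hs).1.le _)) (norm_nonneg _),
        ofReal_norm, Lp.enorm_def]
      gcongr
      exact hE0 _ (hmem s hs)) hint k
  rw [← mul_assoc] at hbound
  refine (ENNReal.ofReal_le_ofReal hbound).trans ?_
  -- The Bochner integral may be replaced by a lower integral because `hint` guarantees convergence;
  -- the reflection `s ↦ t - s` then gives the Volterra form.
  rw [ENNReal.ofReal_mul (by positivity), ofReal_integral_eq_lintegral_ofReal hint]
  · refine mul_le_mul_right ?_ _
    rw [← setLIntegral_Ioo_reflect]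
    refine (setLIntegral_congr_fun measurableSet_Ioo fun s hs => ?_).le
    rw [ENNReal.ofReal_mul (Real.rpow_nonneg (by linarith [hs.2]) _), sub_sub_cancel]
  · filter_upwards [ae_restrict_mem measurableSet_Ioo] with s hs
    exact mul_nonneg (Real.rpow_nonneg hs.1.le _) (hh0 _ (hmem s hs).1)

/-- `E₁` is controlled only on `(0, T]`, so its norm is extended by zero to obtain the globally
measurable and integrable function that `le_of_volterra` requires. -/
lemma IsMildSolution.norm_field_le_rpow {T a ω : ℝ} {w : ℝ → L2Phase} {E1 : ℝ → L2Field}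
    (hsol : IsMildSolution T w E1) (hw : ∀ t ∈ Icc 0 T, ‖w t‖ = ‖w 0‖) (ha : 0 ≤ a)
    (hω0 : 0 ≤ ω) (hω : ω < 1)
    (hE0 : ∀ r ∈ Ioc 0 T, eLpNorm (field0 (w 0) r) 2 volume ≤ ENNReal.ofReal (a * r ^ (-ω)))
    {t : ℝ} (ht : t ∈ Ioc 0 T) :
    ‖E1 t‖ ≤ volterraConst ω a (9 * ‖w 0‖) T *
      (1 + 2 * (8 * (9 * ‖w 0‖) ^ 2) * T * Real.exp (8 * (9 * ‖w 0‖) ^ 2 * T)) *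
        t ^ (1 / 2 - ω) := by
  let e : ℝ → ℝ := (Ioc 0 T).indicator fun r => ‖E1 r‖
  have heq : ∀ r ∈ Ioc 0 T, e r = ‖E1 r‖ := fun r hr => indicator_of_mem hr _
  have hem : Measurable e := by
    classical
    have := ContinuousOn.measurable_piecewise (s := Ioc 0 T) (f := fun r => ‖E1 r‖)
      (g := 0) hsol.field_continuousOn.norm continuousOn_const measurableSet_Ioc
    rwa [piecewise_eq_indicator] at this
  have h := le_of_volterra hω0 hω ha (b := 9 * ‖w 0‖) (by positivity) hem
    (fun r => indicator_nonneg (fun _ _ => norm_nonneg _) r)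
    ((integrable_indicator_iff measurableSet_Ioc).2 hsol.field_integrableOn) (fun t ht => by
      rw [heq t ht]
      refine (hsol.norm_field_le hw ha hω hE0 ht).trans (le_of_eq ?_)
      congr 1
      refine setLIntegral_congr_fun measurableSet_Ioo fun r hr => ?_
      simp only [heq r ⟨hr.1, hr.2.le.trans ht.2⟩]) t ht
  rwa [heq t ht] at h

end WP

end

/-! ### The proposition. -/

theorem proposition4p2 :
    ∃ C₀ : ℝ, 0 < C₀ ∧ ∀ ω ∈ Set.Ico (0 : ℝ) 1,
      ∃ C₁ : ℝ → ℝ → ℝ → ℝ, (∀ a b : ℝ, ContinuousOn (C₁ a b) (Set.Ioi 0)) ∧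
        ∀ (T K : ℝ) (w : ℝ → WP.L2Phase) (E1 : ℝ → WP.L2Field), 0 < T →
          WP.IsMildSolution T w E1 →
          (∀ t ∈ Set.Icc 0 T, ‖w t‖ = ‖w 0‖) →
          WP.ConditionB ω T K (w 0) →
          ∀ t ∈ Set.Ioc 0 T,
            ((∀ᵐ x : WP.R3, MeasureTheory.Integrable
                (fun y : WP.R3 => WP.freeDensity (w 0) t y • WP.coulomb (x - y))) ∧
              MeasureTheory.MemLp (WP.field0 (w 0) t) 2 MeasureTheory.volume ∧
              WP.lpNorm 2 (WP.field0 (w 0) t)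
                ≤ C₀ * WP.lpNorm (6 / 5) (WP.freeDensity (w 0) t) ∧
              C₀ * WP.lpNorm (6 / 5) (WP.freeDensity (w 0) t) ≤ C₀ * K * t ^ (-ω)) ∧
            ‖E1 t‖ ≤ C₁ ‖w 0‖
              (⨆ s : Set.Ioc (0 : ℝ) T,
                (s : ℝ) ^ ω * WP.lpNorm (6 / 5) (WP.freeDensity (w 0) (s : ℝ))) T
              * t ^ (1 / 2 - ω) := by
  obtain ⟨C, hC, hfield⟩ := WP.coulombField_memLp_two
  -- Here `a` stands for `‖w₀‖` and `A` for the supremum in condition (B): Hardy–Littlewood–Sobolev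
  -- gives `‖E₀(r)‖ ≤ C A r^{-ω}`, and `9 a` is the Volterra constant.
  refine ⟨C, hC, fun ω hω => ⟨fun a A T => WP.volterraConst ω (C * A) (9 * a) T *
    (1 + 2 * (8 * (9 * a) ^ 2) * T * Real.exp (8 * (9 * a) ^ 2 * T)),
    fun a A => (WP.continuous_gronwallConst ω (C * A) (9 * a)).continuousOn,
    fun T K w E1 hT hsol hw hB t ht => ?_⟩⟩
  have h0 := fun (r : ℝ) (hr : r ∈ Set.Ioc 0 T) => hfield (WP.freeDensity (w 0) r)
    (WP.stronglyMeasurable_freeDensity (MeasureTheory.Lp.stronglyMeasurable (w 0)) r)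
    (hB.memLp r hr)
  refine ⟨⟨(h0 t ht).1, (h0 t ht).2.1, (h0 t ht).2.2, ?_⟩, ?_⟩
  · rw [mul_assoc]
    exact mul_le_mul_of_nonneg_left (hB.bound t ht) hC.le
  set A := ⨆ s : Set.Ioc (0 : ℝ) T,
    (s : ℝ) ^ ω * WP.lpNorm (6 / 5) (WP.freeDensity (w 0) (s : ℝ)) with hA
  -- A real supremum of an unbounded family is `0` by convention, so boundedness, here by `K`, must
  -- be established before the supremum dominates its terms.
  have hbdd : BddAbove (Set.range fun s : Set.Ioc (0 : ℝ) T =>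
      (s : ℝ) ^ ω * WP.lpNorm (6 / 5) (WP.freeDensity (w 0) (s : ℝ))) := by
    refine ⟨K, ?_⟩
    rintro _ ⟨s, rfl⟩
    have hs := s.2.1
    calc (s : ℝ) ^ ω * WP.lpNorm (6 / 5) (WP.freeDensity (w 0) (s : ℝ))
        ≤ (s : ℝ) ^ ω * (K * (s : ℝ) ^ (-ω)) :=
          mul_le_mul_of_nonneg_left (hB.bound s s.2) (Real.rpow_nonneg hs.le _)
      _ = K := by
          rw [mul_left_comm, ← Real.rpow_add hs, add_neg_cancel, Real.rpow_zero, mul_one]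
  have hA0 : 0 ≤ A := Real.iSup_nonneg fun s =>
    mul_nonneg (Real.rpow_nonneg s.2.1.le _) ENNReal.toReal_nonneg
  refine hsol.norm_field_le_rpow hw (mul_nonneg hC.le hA0) hω.1 hω.2 (fun r hr => ?_) ht
  have hle : r ^ ω * WP.lpNorm (6 / 5) (WP.freeDensity (w 0) r) ≤ A := le_ciSup hbdd ⟨r, hr⟩
  rw [WP.field0, ← ENNReal.ofReal_toReal (h0 r hr).2.1.eLpNorm_ne_top]
  apply ENNReal.ofReal_le_ofReal
  refine (h0 r hr).2.2.trans ?_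
  rw [mul_assoc]
  refine mul_le_mul_of_nonneg_left ?_ hC.le
  rw [Real.rpow_neg hr.1.le, ← div_eq_mul_inv, le_div_iff₀ (Real.rpow_pos_of_pos hr.1 _), mul_comm]
  exact hle
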